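/- For a number field $K$ with ring of integers $\mathcal O_K$ and $S=\operatorname{Spec}\mathcal O_K$, a hermitian vector bundle $\overline F$ over $S$ is a finitely generated projective $\mathcal O_K$-module $F$ with, for every embedding $\sigma:K\hookrightarrow\mathbb C$, a positive definite hermitian scalar product on $F_\sigma=F\otimes_{\mathcal O_K,\sigma}\mathbb C$, the family being invariant under complex conjugation. An arithmetic extension of $F$ by $G$ over $S$ is an extension $0\to G\to E\to F\to 0$ of $\mathcal O_K$-modules together with a family of $\mathbb C$-linear splittings $s_\sigma:F_\sigma\to E_\sigma$ that is invariant under complex conjugation; $\widehat{\mathrm{Ext}}^1_S(F,G)$ is the set of isomorphism classes of arithmetic extensions, isomorphisms inducing the identity on $F$ and $G$ and respecting the splittings. For a conjugation invariant family $T=(T_\sigma)$ in $\bigoplus_\sigma\mathrm{Hom}_{\mathbb C}(F_\sigma,G_\sigma)$ let $b(T)$ be the class of the trivial extension $G\oplus F$ with splitting $f\mapsto(T_\sigma f,f)$. The size of a class $e\in\widehat{\mathrm{Ext}}^1_S(F,G)$ is $$\mathfrak s_{\overline F,\overline G}(e)=\log\,\inf\Bigl\{\Bigl(\tfrac1{[K:\mathbb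 Q]}\sum_{\sigma}\|T_\sigma\|_\sigma^2\Bigr)^{1/2}\ \Big|\ b(T)=e\Bigr\}\in\mathbb R\cup\{-\infty\},$$ where $\|T_\sigma\|_\sigma$ is the Hilbert--Schmidt norm. Put $s(n)=\frac32\,n\log n$ for integers $n\ge1$ and $s(0)=0$. Let $L$ be any number field and $g:\operatorname{Spec}\mathcal O_L\to\operatorname{Spec}\mathbb Z$ the unique morphism. Then, for all hermitian vector bundles $\overline F,\overline G$ over $\operatorname{Spec}\mathbb Z$ and every $e\in\widehat{\mathrm{Ext}}^1_{\operatorname{Spec}\mathbb Z}(F,G)$, the inverse image $g^*e\in\widehat{\mathrm{Ext}}^1_{\operatorname{Spec}\mathcal O_L}(g^*F,g^*G)$ satisfies $$\mathfrak s_{\overline F,\overline G}(e)-s(\operatorname{rk}F\cdot\operatorname{rk}G)\ \le\ \mathfrak s_{g^*\overline F,g^*\overline G}(g^*e)\ \le\ \mathfrak s_{\overline F,\overline G}(e).$$ -/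

import Mathlib

open scoped TensorProduct ComplexConjugate

noncomputable section

namespace Arakelov

/-! ### Complex embeddings and complex fibres

The arithmetic curve `Spec R` is given by a ring `R` such as `ℤ` or the ring of integers `𝓞 K` of a
number field. Its set of complex embeddings is `R →+* ℂ`; for `R = 𝓞 K`, restriction identifies it
with the set of field embeddings of `K` into `ℂ` (see `embEquiv` below). -/

/-- Restricting to the ring of integers identifies the field embeddings `K → ℂ` with the
ring homomorphisms `𝓞 K → ℂ`. -/
def embEquiv (K : Type*) [Field K] [NumberField K] :
    (K →+* ℂ) ≃ (NumberField.RingOfIntegers K →+* ℂ) :=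
  Equiv.ofBijective
    (fun σ => σ.comp (algebraMap (NumberField.RingOfIntegers K) K)) <| by
    constructor
    · intro σ τ h
      exact IsLocalization.ringHom_ext (nonZeroDivisors (NumberField.RingOfIntegers K)) h
    · intro ρ
      have hinj : Function.Injective ρ := by
        rw [injective_iff_map_eq_zero]
        intro x hx
        by_contra hne
        obtain ⟨y, hy⟩ := Ideal.mem_span_singleton'.mp (Ideal.absNorm_mem (Ideal.span {x}))
        have h := congrArg ρ hy
        rw [map_mul, hx, mul_zero, map_natCast, eq_comm, Nat.cast_eq_zero,
          Ideal.absNorm_eq_zero_iff, Ideal.span_singleton_eq_bot] at h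
        exact hne h
      exact ⟨IsFractionRing.lift hinj, by
        ext x
        simp⟩

instance embFintype (K : Type*) [Field K] [NumberField K] :
    Fintype (NumberField.RingOfIntegers K →+* ℂ) :=
  Fintype.ofEquiv _ (embEquiv K)

instance intEmbFintype : Fintype (ℤ →+* ℂ) :=
  Fintype.ofSubsingleton (Int.castRingHom ℂ)

section Fibres

variable {R : Type*} [CommRing R]

/-- The complex conjugate `σ̄` of an embedding `σ`. -/
def conjEmb (σ : R →+* ℂ) : R →+* ℂ := (starRingEnd ℂ).comp σ

/-- The field `ℂ`, seen as an `R`-algebra through the embedding `σ`. -/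
def CAt (_σ : R →+* ℂ) : Type := ℂ

instance (σ : R →+* ℂ) : Field (CAt σ) := inferInstanceAs (Field ℂ)

instance (σ : R →+* ℂ) : Algebra ℂ (CAt σ) := inferInstanceAs (Algebra ℂ ℂ)

instance (σ : R →+* ℂ) : Module.Finite ℂ (CAt σ) := inferInstanceAs (Module.Finite ℂ ℂ)

instance CAt.algebra (σ : R →+* ℂ) : Algebra R (CAt σ) := σ.toAlgebra

instance (σ : R →+* ℂ) : SMulCommClass R ℂ (CAt σ) :=
  ⟨fun r z w => mul_left_comm (σ r) z w⟩

/-- The fibre `E_σ = ℂ ⊗_{R, σ} E` of an `R`-module `E` at an embedding `σ`. -/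
abbrev Fiber (σ : R →+* ℂ) (E : Type*) [AddCommGroup E] [Module R E] : Type _ :=
  CAt σ ⊗[R] E

/-- Complex conjugation `ℂ → ℂ`, as an `R`-linear map when `R` acts on the source through `σ` and on
the target through `σ̄`. -/
def conjCAt (σ : R →+* ℂ) : CAt σ →ₗ[R] CAt (conjEmb σ) where
  toFun z := (starRingEnd ℂ) z
  map_add' := (starRingEnd ℂ).map_add
  map_smul' r z := (starRingEnd ℂ).map_mul (σ r) z

/-- Complex conjugation `E_σ → E_σ̄`, `z ⊗ e ↦ z̄ ⊗ e`. -/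
def fiberConj (σ : R →+* ℂ) (E : Type*) [AddCommGroup E] [Module R E] :
    Fiber σ E →ₗ[R] Fiber (conjEmb σ) E :=
  (conjCAt σ).rTensor E

/-- The `ℂ`-linear map `f_σ : M_σ → N_σ` induced by an `R`-linear map `f : M → N`. -/
def fiberMap (σ : R →+* ℂ) {M N : Type*} [AddCommGroup M] [Module R M] [AddCommGroup N]
    [Module R N] (f : M →ₗ[R] N) : Fiber σ M →ₗ[ℂ] Fiber σ N :=
  { f.lTensor (CAt σ) with
    map_smul' := fun z x => (f.baseChange (CAt σ)).map_smul (show CAt σ from z) x }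

instance (σ : R →+* ℂ) (E : Type*) [AddCommGroup E] [Module R E] [Module.Finite R E] :
    Module.Finite ℂ (Fiber σ E) :=
  inferInstanceAs (Module.Finite (CAt σ) (CAt σ ⊗[R] E))

/-- A family of `ℂ`-linear maps `T_σ : M_σ → N_σ`, indexed by all embeddings `σ`, is
`F_∞`-invariant if it commutes with complex conjugation. -/
def ConjInvariant {M N : Type*} [AddCommGroup M] [Module R M] [AddCommGroup N] [Module R N]
    (T : ∀ σ : R →+* ℂ, Fiber σ M →ₗ[ℂ] Fiber σ N) : Prop :=
  ∀ σ x, T (conjEmb σ) (fiberConj σ M x) = fiberConj σ N (T σ x)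

end Fibres

/-! ### Hermitian vector bundles -/

/-- A hermitian structure on a vector bundle `E` over `Spec R`: a positive definite hermitian scalar
product on every fibre `E_σ`, the whole family being invariant under complex conjugation.
A hermitian vector bundle over `Spec R` is a finitely generated projective `R`-module together with
such a structure. -/
structure HermitianMetric (R : Type*) [CommRing R] (E : Type*) [AddCommGroup E] [Module R E] where
  /-- the hermitian scalar product on `E_σ` -/
  core : ∀ σ : R →+* ℂ, InnerProductSpace.Core ℂ (Fiber σ E)
  /-- invariance under complex conjugation -/
  conj_invariant : ∀ (σ : R →+* ℂ) (x y : Fiber σ E),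
    (core (conjEmb σ)).inner (fiberConj σ E x) (fiberConj σ E y) = conj ((core σ).inner x y)

/-- The square `tr (T* T)` of the Hilbert-Schmidt norm of a linear map `T` between
finite-dimensional complex vector spaces equipped with hermitian scalar products. -/
def hsNormSq {V W : Type*} [AddCommGroup V] [Module ℂ V] [Module.Finite ℂ V]
    [AddCommGroup W] [Module ℂ W] [Module.Finite ℂ W]
    (cV : InnerProductSpace.Core ℂ V) (cW : InnerProductSpace.Core ℂ W) (T : V →ₗ[ℂ] W) : ℝ :=
  letI : NormedAddCommGroup V := cV.toNormedAddCommGroup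
  letI : InnerProductSpace ℂ V := InnerProductSpace.ofCore cV.toCore
  letI : NormedAddCommGroup W := cW.toNormedAddCommGroup
  letI : InnerProductSpace ℂ W := InnerProductSpace.ofCore cW.toCore
  (LinearMap.trace ℂ V (LinearMap.adjoint T ∘ₗ T)).re

/-! ### Arithmetic extensions -/

section Extensions

universe r u v

variable (R : Type r) [CommRing R] (F : Type u) [AddCommGroup F] [Module R F]
  (G : Type v) [AddCommGroup G] [Module R G]

/-- An arithmetic extension of `F` by `G` over `Spec R`: an extension
`0 → G → E → F → 0` of `R`-modules together with a conjugation invariant family `s` of `ℂ`-linear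
splittings `s_σ : F_σ → E_σ`. -/
structure ArithExtension where
  /-- the middle term of the extension -/
  E : Type (max u v)
  [addCommGroup : AddCommGroup E]
  [module : Module R E]
  /-- the injection `G → E` -/
  i : G →ₗ[R] E
  /-- the surjection `E → F` -/
  p : E →ₗ[R] F
  injective : Function.Injective i
  exact : Function.Exact i p
  surjective : Function.Surjective p
  /-- the splittings at the embeddings -/
  s : ∀ σ : R →+* ℂ, Fiber σ F →ₗ[ℂ] Fiber σ E
  splits : ∀ σ, fiberMap σ p ∘ₗ s σ = LinearMap.id
  conj_invariant : ConjInvariant s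

attribute [instance] ArithExtension.addCommGroup ArithExtension.module

variable {R F G}

/-- An isomorphism between arithmetic extensions of `F` by `G` exists: an isomorphism of the middle
terms that induces the identity on `G` and `F` and is compatible with the splittings. -/
def ArithExtension.IsIso (X Y : ArithExtension R F G) : Prop :=
  ∃ φ : X.E ≃ₗ[R] Y.E, φ.toLinearMap ∘ₗ X.i = Y.i ∧ Y.p ∘ₗ φ.toLinearMap = X.p ∧
    ∀ σ, fiberMap σ φ.toLinearMap ∘ₗ X.s σ = Y.s σ

theorem fiberMap_comp (σ : R →+* ℂ) {M N P : Type*} [AddCommGroup M] [Module R M]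
    [AddCommGroup N] [Module R N] [AddCommGroup P] [Module R P] (g : N →ₗ[R] P) (f : M →ₗ[R] N) :
    fiberMap σ (g ∘ₗ f) = fiberMap σ g ∘ₗ fiberMap σ f :=
  LinearMap.ext fun x => LinearMap.lTensor_comp_apply (CAt σ) g f x

theorem fiberMap_zero (σ : R →+* ℂ) {M N : Type*} [AddCommGroup M] [Module R M]
    [AddCommGroup N] [Module R N] : fiberMap σ (0 : M →ₗ[R] N) = 0 :=
  LinearMap.ext fun x => congrArg (fun f : CAt σ ⊗[R] M →ₗ[R] CAt σ ⊗[R] N => f x)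
    (LinearMap.lTensor_zero (CAt σ))

theorem fiberMap_id (σ : R →+* ℂ) {M : Type*} [AddCommGroup M] [Module R M] :
    fiberMap σ (LinearMap.id : M →ₗ[R] M) = LinearMap.id :=
  LinearMap.ext fun x => LinearMap.lTensor_id_apply (CAt σ) M x

theorem fiberMap_tmul (σ : R →+* ℂ) {M N : Type*} [AddCommGroup M] [Module R M] [AddCommGroup N]
    [Module R N] (f : M →ₗ[R] N) (z : CAt σ) (m : M) :
    fiberMap σ f (z ⊗ₜ[R] m) = z ⊗ₜ[R] f m := rfl

theorem fiberConj_tmul (σ : R →+* ℂ) {M : Type*} [AddCommGroup M] [Module R M]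
    (z : CAt σ) (m : M) : fiberConj σ M (z ⊗ₜ[R] m) = conjCAt σ z ⊗ₜ[R] m := rfl

theorem fiberMap_conj (σ : R →+* ℂ) {M N : Type*} [AddCommGroup M] [Module R M] [AddCommGroup N]
    [Module R N] (f : M →ₗ[R] N) (x : Fiber σ M) :
    fiberMap (conjEmb σ) f (fiberConj σ M x) = fiberConj σ N (fiberMap σ f x) := by
  induction x using TensorProduct.induction_on with
  | zero => simp only [map_zero]
  | tmul z m => simp only [fiberMap_tmul, fiberConj_tmul]
  | add x y hx hy => simp only [map_add, hx, hy]

theorem ArithExtension.isIso_equivalence :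
    Equivalence (ArithExtension.IsIso (R := R) (F := F) (G := G)) where
  refl X := ⟨LinearEquiv.refl R X.E, rfl, rfl, fun σ => by
    simp only [LinearEquiv.refl_toLinearMap, fiberMap_id, LinearMap.id_comp]⟩
  symm := by
    rintro X Y ⟨φ, hi, hp, hs⟩
    refine ⟨φ.symm, ?_, ?_, fun σ => ?_⟩
    · rw [← hi]; ext; simp
    · rw [← hp]; ext; simp
    · rw [← hs, ← LinearMap.comp_assoc, ← fiberMap_comp]
      simp only [LinearEquiv.symm_comp, fiberMap_id, LinearMap.id_comp]
  trans := by
    rintro X Y Z ⟨φ, hi, hp, hs⟩ ⟨ψ, hi', hp', hs'⟩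
    refine ⟨φ.trans ψ, ?_, ?_, fun σ => ?_⟩
    · rw [← hi', ← hi]; rfl
    · rw [← hp, ← hp']; rfl
    · rw [← hs', ← hs, ← LinearMap.comp_assoc, ← fiberMap_comp]; rfl

instance ArithExtension.setoid : Setoid (ArithExtension R F G) :=
  ⟨ArithExtension.IsIso, ArithExtension.isIso_equivalence⟩

variable (R F G) in
/-- The arithmetic extension group of `F` by `G` over `Spec R`, as the set of isomorphism classes of
arithmetic extensions of `F` by `G`. -/
def ArithExt : Type _ := Quotient (ArithExtension.setoid (R := R) (F := F) (G := G))

/-- The arithmetic extension with underlying trivial extension `G × F` of `F` by `G` and with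
splitting `s(f) = (T f, f)`. -/
def trivialExtension (T : ∀ σ : R →+* ℂ, Fiber σ F →ₗ[ℂ] Fiber σ G) (hT : ConjInvariant T) :
    ArithExtension R F G where
  E := G × F
  i := LinearMap.inl R G F
  p := LinearMap.snd R G F
  injective := LinearMap.inl_injective
  exact := Function.Exact.inl_snd
  surjective := LinearMap.snd_surjective
  s σ := fiberMap σ (LinearMap.inl R G F) ∘ₗ T σ + fiberMap σ (LinearMap.inr R G F)
  splits σ := by
    rw [LinearMap.comp_add, ← LinearMap.comp_assoc, ← fiberMap_comp, ← fiberMap_comp,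
      LinearMap.snd_comp_inr, fiberMap_id, LinearMap.snd_comp_inl]
    rw [fiberMap_zero, LinearMap.zero_comp, zero_add]
  conj_invariant σ x := by
    simp only [LinearMap.add_apply, LinearMap.comp_apply, hT σ x, fiberMap_conj, map_add]

/-- The map `b` from conjugation invariant families `T_σ : F_σ → G_σ` to the classes of arithmetic
extensions. -/
def classOf (T : ∀ σ : R →+* ℂ, Fiber σ F →ₗ[ℂ] Fiber σ G) (hT : ConjInvariant T) :
    ArithExt R F G :=
  Quotient.mk _ (trivialExtension T hT)

/-- The size of a class `e` of arithmetic extensions of `F` by `G`, with respect to hermitian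
structures on `F` and `G`: the logarithm of the infimum of
`((1/d) ∑_σ ‖T_σ‖²)^{1/2}` over all conjugation invariant families `T_σ : F_σ → G_σ` with class `e`,
where `‖·‖` is the Hilbert-Schmidt norm and `d` the rank of `R` over `ℤ` (that is `[K : ℚ]` for
`R = 𝓞 K`). It is `-∞ = ⊥` when the infimum is `0`. -/
def size [Fintype (R →+* ℂ)] [Module.Finite R F] [Module.Finite R G]
    (hF : HermitianMetric R F) (hG : HermitianMetric R G) (e : ArithExt R F G) : EReal :=
  ENNReal.log (⨅ (T : ∀ σ : R →+* ℂ, Fiber σ F →ₗ[ℂ] Fiber σ G) (hT : ConjInvariant T)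
    (_ : classOf T hT = e),
    ENNReal.ofReal (Real.sqrt
      ((1 / (Module.finrank ℤ R : ℝ)) * ∑ σ, hsNormSq (hF.core σ) (hG.core σ) (T σ))))

end Extensions

/-! ### Base change along `Spec R' → Spec R` -/

section BaseChange

universe r r' u v

variable {R : Type r} [CommRing R] (R' : Type r') [CommRing R'] [Algebra R R']

variable {R'} in
/-- The canonical isomorphism `(R' ⊗_R E)_τ ≃ E_σ`, where `σ` is the restriction of `τ` to `R`;
it maps `z ⊗ (a ⊗ e)` to `τ(a) z ⊗ e`. -/
def fiberBaseChange (τ : R' →+* ℂ) (E : Type*) [AddCommGroup E] [Module R E] :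
    Fiber τ (R' ⊗[R] E) ≃ₗ[ℂ] Fiber (τ.comp (algebraMap R R')) E :=
  letI : Algebra R (CAt τ) := CAt.algebra (τ.comp (algebraMap R R'))
  haveI : IsScalarTower R R' (CAt τ) := IsScalarTower.of_algebraMap_eq fun _ => rfl
  let c := TensorProduct.AlgebraTensorModule.cancelBaseChange R R' (CAt τ) (CAt τ) E
  { c.toAddEquiv with
    map_smul' := fun z x => c.map_smul (show CAt τ from z) x }

variable {R'} in
theorem fiberBaseChange_symm_tmul (τ : R' →+* ℂ) {E : Type*} [AddCommGroup E] [Module R E]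
    (z : CAt (τ.comp (algebraMap R R'))) (e : E) :
    (fiberBaseChange τ E).symm (z ⊗ₜ[R] e) = (show CAt τ from z) ⊗ₜ[R'] ((1 : R') ⊗ₜ[R] e) :=
  rfl

variable {R'} in
theorem fiberBaseChange_symm_conj (τ : R' →+* ℂ) {E : Type*} [AddCommGroup E] [Module R E]
    (x : Fiber (τ.comp (algebraMap R R')) E) :
    (fiberBaseChange (conjEmb τ) E).symm (fiberConj (τ.comp (algebraMap R R')) E x) =
      fiberConj τ (R' ⊗[R] E) ((fiberBaseChange τ E).symm x) := by
  induction x using TensorProduct.induction_on with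
  | zero =>
    simp only [map_zero]
    exact map_zero _
  | tmul z m => rfl
  | add x y hx hy =>
    rw [map_add, map_add, map_add, ← hx, ← hy]
    exact map_add _ _ _

variable {R'} in
theorem fiberBaseChange_conj (τ : R' →+* ℂ) {E : Type*} [AddCommGroup E] [Module R E]
    (x : Fiber τ (R' ⊗[R] E)) :
    fiberBaseChange (conjEmb τ) E (fiberConj τ (R' ⊗[R] E) x) =
      fiberConj (τ.comp (algebraMap R R')) E (fiberBaseChange τ E x) := by
  obtain ⟨y, rfl⟩ := (fiberBaseChange τ E).symm.surjective x
  rw [← fiberBaseChange_symm_conj, LinearEquiv.apply_symm_apply]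
  exact LinearEquiv.apply_symm_apply _ _

variable {R'} in
theorem fiberMap_fiberBaseChange_symm (τ : R' →+* ℂ) {M N : Type*} [AddCommGroup M] [Module R M]
    [AddCommGroup N] [Module R N] (f : M →ₗ[R] N) (x : Fiber (τ.comp (algebraMap R R')) M) :
    fiberMap τ (f.baseChange R') ((fiberBaseChange τ M).symm x) =
      (fiberBaseChange τ N).symm (fiberMap (τ.comp (algebraMap R R')) f x) := by
  induction x using TensorProduct.induction_on with
  | zero => simp only [map_zero]
  | tmul z m => rfl
  | add x y hx hy => simp only [map_add, hx, hy]

/-- The inverse image of a hermitian structure on `E` along `Spec R' → Spec R`: the fibre of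
`R' ⊗_R E` at `τ` is the fibre of `E` at the restriction of `τ` to `R`, with the same scalar
product. -/
def HermitianMetric.baseChange {E : Type*} [AddCommGroup E] [Module R E]
    (h : HermitianMetric R E) : HermitianMetric R' (R' ⊗[R] E) where
  core τ :=
    { inner := fun x y => (h.core (τ.comp (algebraMap R R'))).inner
        (fiberBaseChange τ E x) (fiberBaseChange τ E y)
      conj_inner_symm := fun x y => (h.core _).conj_inner_symm _ _
      re_inner_nonneg := fun x => (h.core _).re_inner_nonneg _
      add_left := fun x y z => by rw [map_add]; exact (h.core _).add_left _ _ _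
      smul_left := fun x y r => by rw [map_smul]; exact (h.core _).smul_left _ _ _
      definite := fun x hx =>
        (LinearEquiv.map_eq_zero_iff (fiberBaseChange τ E)).mp ((h.core _).definite _ hx) }
  conj_invariant τ x y := by
    change (h.core (conjEmb (τ.comp (algebraMap R R')))).inner
      (fiberBaseChange (conjEmb τ) E (fiberConj τ (R' ⊗[R] E) x))
      (fiberBaseChange (conjEmb τ) E (fiberConj τ (R' ⊗[R] E) y)) = _
    rw [fiberBaseChange_conj, fiberBaseChange_conj]
    exact h.conj_invariant _ _ _

variable {F : Type u} [AddCommGroup F] [Module R F] {G : Type v} [AddCommGroup G] [Module R G]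

/-- The inverse image of an arithmetic extension along a flat morphism `Spec R' → Spec R`: tensor
the extension with `R'`; the splitting at `τ` is the splitting at the restriction of `τ` to `R`. -/
def ArithExtension.baseChange [Module.Flat R R'] (X : ArithExtension R F G) :
    ArithExtension R' (R' ⊗[R] F) (R' ⊗[R] G) where
  E := R' ⊗[R] X.E
  i := X.i.baseChange R'
  p := X.p.baseChange R'
  injective := Module.Flat.lTensor_preserves_injective_linearMap X.i X.injective
  exact := lTensor_exact R' X.exact X.surjective
  surjective := LinearMap.lTensor_surjective R' X.surjective
  s τ := (fiberBaseChange τ X.E).symm.toLinearMap ∘ₗ X.s (τ.comp (algebraMap R R')) ∘ₗ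
    (fiberBaseChange τ F).toLinearMap
  splits τ := by
    ext1 x
    simp only [LinearMap.comp_apply, LinearEquiv.coe_coe, fiberMap_fiberBaseChange_symm]
    rw [← LinearMap.comp_apply, X.splits]
    exact LinearEquiv.symm_apply_apply _ _
  conj_invariant τ x := by
    simp only [LinearMap.comp_apply, LinearEquiv.coe_coe]
    rw [fiberBaseChange_conj, ← fiberBaseChange_symm_conj]
    exact congrArg _ (X.conj_invariant (τ.comp (algebraMap R R')) (fiberBaseChange τ F x))

theorem ArithExtension.baseChange_isIso [Module.Flat R R'] {X Y : ArithExtension R F G}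
    (h : X.IsIso Y) : (X.baseChange R').IsIso (Y.baseChange R') := by
  obtain ⟨φ, hi, hp, hs⟩ := h
  refine ⟨φ.baseChange R R' X.E Y.E, ?_, ?_, fun τ => ?_⟩
  · change φ.toLinearMap.baseChange R' ∘ₗ X.i.baseChange R' = Y.i.baseChange R'
    rw [← hi, LinearMap.baseChange_comp]
  · change Y.p.baseChange R' ∘ₗ φ.toLinearMap.baseChange R' = X.p.baseChange R'
    rw [← hp, LinearMap.baseChange_comp]
  · ext1 x
    change fiberMap τ (φ.toLinearMap.baseChange R') ((fiberBaseChange τ X.E).symm _) =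
      (fiberBaseChange τ Y.E).symm _
    rw [fiberMap_fiberBaseChange_symm]
    exact congrArg _ (LinearMap.congr_fun (hs _) _)

/-- The base change map on classes of arithmetic extensions along a flat morphism
`Spec R' → Spec R`. -/
def ArithExt.baseChange [Module.Flat R R'] (e : ArithExt R F G) :
    ArithExt R' (R' ⊗[R] F) (R' ⊗[R] G) :=
  Quotient.map (ArithExtension.baseChange R')
    (fun _ _ h => ArithExtension.baseChange_isIso R' h) e

end BaseChange

end Arakelov

end

/-! Two families have the same class under `b` exactly when they differ by an integral map `F → G`
(`classOf_eq_iff`). Thus the size of `e` measures the Hilbert-Schmidt distance of a representative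
`T` to the lattice `Hom(F, G)`, and the size of `g^*e` measures the normalised distance of the
pulled back `T` to the larger module of `𝓞 L`-linear maps. Pulling back does not change the mean
norm, because every embedding of `𝓞 L` restricts to the unique embedding of `ℤ`; this gives the
upper bound.

For the lower bound, `T` is tested against the dual lattice `Hom(G, F)` by the trace pairing.
Suppose `T + u'` has mean square norm `E` over `𝓞 L`. By Cauchy-Schwarz, for every `y : G → F` the
real number `tr (y T)` lies within `√E ‖y‖` of an element of `𝓞 L`, in root mean square over the
embeddings. For a real number, `ℤ` approximates at least as well as `𝓞 L` (`exists_int_sq_sub_le`),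
so `tr (y T)` is within `√E ‖y‖` of an integer.

The transference bound `exists_int_functional` turns these separate integers into one integral
functional, by induction on the rank along shortest vectors, at the price of a factor `2 ^ n - 1`
with `n = rk F * rk G`. The trace pairing is perfect over `ℤ`, so that functional is an integral map
`u`, and `T - u` has norm at most `(2 ^ n - 1) √E` (`exists_hsNormSq_sub_le`). Finally `2 ^ n - 1 ≤
exp (s n)`. -/

namespace Arakelov

/-! ### Approximating a real number by algebraic integers -/

section RankOne

variable {L : Type*} [Field L] [NumberField L]

theorem card_emb : (Fintype.card (NumberField.RingOfIntegers L →+* ℂ)) =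
    Module.finrank ℤ (NumberField.RingOfIntegers L) := by
  rw [NumberField.RingOfIntegers.rank, ← NumberField.Embeddings.card L ℂ]
  exact (Fintype.card_congr (embEquiv L)).symm

/-- The product is the absolute value of the norm of `x`, a nonzero integer. -/
theorem one_le_prod_norm_emb {x : NumberField.RingOfIntegers L} (hx : x ≠ 0) :
    1 ≤ ∏ τ : NumberField.RingOfIntegers L →+* ℂ, ‖τ x‖ := by
  have h1 : ∏ τ : NumberField.RingOfIntegers L →+* ℂ, ‖τ x‖ = ∏ σ : L →+* ℂ, ‖σ (x : L)‖ :=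
    (Fintype.prod_equiv (embEquiv L) _ _ fun _ => rfl).symm
  have h2 : ∏ σ : L →+* ℂ, ‖σ (x : L)‖ = |(Algebra.norm ℤ x : ℝ)| := by
    have h := Algebra.norm_eq_prod_embeddings ℚ ℂ (x : L)
    have h' : ∏ σ : L →+* ℂ, σ (x : L) = ∏ σ : L →ₐ[ℚ] ℂ, σ (x : L) :=
      Fintype.prod_equiv (RingHom.equivRatAlgHom L ℂ) _ _ fun _ => rfl
    rw [← norm_prod, h', ← h, ← Algebra.coe_norm_int]
    simp
  rw [h1, h2]
  have h3 : Algebra.norm ℤ x ≠ 0 := by rwa [Ne, Algebra.norm_eq_zero_iff]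
  exact_mod_cast Int.one_le_abs h3

/-- The arithmetic mean of the `‖τ x‖ ^ 2` dominates their geometric mean, which is at least `1`. -/
theorem finrank_le_sum_norm_sq {x : NumberField.RingOfIntegers L} (hx : x ≠ 0) :
    (Module.finrank ℤ (NumberField.RingOfIntegers L) : ℝ) ≤
      ∑ τ : NumberField.RingOfIntegers L →+* ℂ, ‖τ x‖ ^ 2 := by
  have hd : 0 < Fintype.card (NumberField.RingOfIntegers L →+* ℂ) := by
    rw [card_emb]; exact Module.finrank_pos
  have := Real.geom_mean_le_arith_mean (Finset.univ)
    (fun _ : NumberField.RingOfIntegers L →+* ℂ => (1 : ℝ)) (fun τ => ‖τ x‖ ^ 2)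
    (by simp) (by simpa using hd) (by intros; positivity)
  simp only [Real.rpow_one, one_mul, Finset.sum_const, nsmul_eq_mul, mul_one,
    Finset.card_univ] at this
  rw [← card_emb]
  rw [le_div_iff₀ (by exact_mod_cast hd)] at this
  refine le_trans ?_ this
  have : (1 : ℝ) ≤ (∏ τ : NumberField.RingOfIntegers L →+* ℂ, ‖τ x‖ ^ 2) ^
      ((Fintype.card (NumberField.RingOfIntegers L →+* ℂ) : ℝ)⁻¹) := by
    apply Real.one_le_rpow
    · rw [Finset.prod_pow]
      exact one_le_pow₀ (one_le_prod_norm_emb hx)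
    · positivity
  nlinarith [(Nat.cast_pos (α := ℝ)).mpr hd]

/-- The distance of a real number to `ℤ` does not decrease after extending scalars to the ring of
integers of a number field. -/
theorem exists_int_sq_sub_le (t : ℝ) (x : NumberField.RingOfIntegers L) :
    ∃ k : ℤ, (t - k) ^ 2 ≤ (1 / (Module.finrank ℤ (NumberField.RingOfIntegers L) : ℝ)) *
      ∑ τ : NumberField.RingOfIntegers L →+* ℂ, ‖(t : ℂ) - τ x‖ ^ 2 := by
  refine ⟨round t, ?_⟩
  set d : ℝ := (Module.finrank ℤ (NumberField.RingOfIntegers L) : ℝ) with hd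
  have hd0 : 0 < d := by rw [hd]; exact_mod_cast Module.finrank_pos
  set r : ℝ := t - round t with hr
  have hr2 : |r| ≤ 1 / 2 := abs_sub_round t
  obtain ⟨y, rfl⟩ : ∃ y : NumberField.RingOfIntegers L, x = y + (round t : ℤ) :=
    ⟨x - (round t : ℤ), by ring⟩
  have e1 : ∀ τ : NumberField.RingOfIntegers L →+* ℂ,
      ‖(t : ℂ) - τ (y + (round t : ℤ))‖ ^ 2 = ‖τ y‖ ^ 2 - 2 * r * (τ y).re + r ^ 2 := by
    intro τ
    have : (t : ℂ) - τ (y + (round t : ℤ)) = (r : ℂ) - τ y := by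
      rw [map_add, map_intCast, hr]; push_cast; ring
    rw [this, ← Complex.normSq_eq_norm_sq, ← Complex.normSq_eq_norm_sq, Complex.normSq_apply,
      Complex.normSq_apply]
    simp; ring
  simp only [e1]
  rw [Finset.sum_add_distrib, Finset.sum_sub_distrib, ← Finset.mul_sum, Finset.sum_const,
    Finset.card_univ, card_emb, nsmul_eq_mul, ← hd, one_div, ← div_eq_inv_mul,
    le_div_iff₀ hd0]
  set s := ∑ τ : NumberField.RingOfIntegers L →+* ℂ, (τ y).re
  set q := ∑ τ : NumberField.RingOfIntegers L →+* ℂ, ‖τ y‖ ^ 2 with hq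
  -- Expanding the squares around `round t` cancels `r ^ 2`. What remains is at most `|s|` since
  -- `|r| ≤ 1 / 2`. If `|s| ≤ d`, then `d ≤ q` concludes; otherwise `s ^ 2 ≤ d * q ≤ |s| * q` does.
  suffices h : 2 * r * s ≤ q by linarith
  by_cases hy : y = 0
  · simp [s, q, hy]
  have h1 : d ≤ q := finrank_le_sum_norm_sq hy
  have h2 : s ^ 2 ≤ d * q := by
    have := sq_sum_le_card_mul_sum_sq (s := Finset.univ)
      (f := fun τ : NumberField.RingOfIntegers L →+* ℂ => (τ y).re)
    rw [Finset.card_univ, card_emb] at this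
    refine this.trans (mul_le_mul_of_nonneg_left (Finset.sum_le_sum fun τ _ => ?_) hd0.le)
    rw [← sq_abs]
    exact pow_le_pow_left₀ (abs_nonneg _) (Complex.abs_re_le_norm _) 2
  have h3 : 2 * r * s ≤ |s| := by
    calc 2 * r * s ≤ |2 * r * s| := le_abs_self _
      _ = 2 * |r| * |s| := by rw [abs_mul, abs_mul, abs_two]
      _ ≤ |s| := by nlinarith [abs_nonneg s]
  refine h3.trans ?_
  rcases le_total |s| d with h | h
  · exact h.trans h1
  · rw [← sq_abs] at h2
    by_contra hc
    push Not at hc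
    nlinarith

end RankOne

/-! ### Transference for lattices in a real inner product space -/

section Transference

variable {V : Type*} [NormedAddCommGroup V] [InnerProductSpace ℝ V]

/-- The orthogonal projection along the line spanned by `v`. -/
noncomputable def projAlong (v : V) : V →ₗ[ℝ] V :=
  LinearMap.id - (‖v‖ ^ 2)⁻¹ • (LinearMap.toSpanSingleton ℝ V v ∘ₗ (innerₛₗ ℝ v))

theorem projAlong_apply (v x : V) :
    projAlong v x = x - ((‖v‖ ^ 2)⁻¹ * inner ℝ v x) • v := by
  simp [projAlong, smul_smul]

theorem inner_projAlong (v x y : V) :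
    inner ℝ (projAlong v x) y = inner ℝ x (projAlong v y) := by
  simp only [projAlong_apply, inner_sub_left, inner_sub_right, inner_smul_left, inner_smul_right]
  rw [real_inner_comm x v]
  simp; ring

theorem projAlong_self {v : V} (hv : v ≠ 0) : projAlong v v = 0 := by
  have : ‖v‖ ≠ 0 := norm_ne_zero_iff.mpr hv
  rw [projAlong_apply, real_inner_self_eq_norm_sq, inv_mul_cancel₀ (by positivity)]
  simp

theorem norm_sq_eq_projAlong {v : V} (hv : v ≠ 0) (x : V) :
    ‖x‖ ^ 2 = ‖projAlong v x‖ ^ 2 + (inner ℝ v x / ‖v‖) ^ 2 := by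
  have h0 : ‖v‖ ≠ 0 := norm_ne_zero_iff.mpr hv
  rw [projAlong_apply, norm_sub_sq_real, norm_smul, inner_smul_right, real_inner_comm x v, mul_pow,
    Real.norm_eq_abs, sq_abs]
  field_simp
  ring

theorem norm_projAlong_le {v : V} (hv : v ≠ 0) (x : V) : ‖projAlong v x‖ ≤ ‖x‖ := by
  have := norm_sq_eq_projAlong hv x
  exact le_of_sq_le_sq (by nlinarith [sq_nonneg (inner ℝ v x / ‖v‖)]) (norm_nonneg _)

/-- Size reduction with respect to `v`. -/
theorem exists_int_abs_inner_le {v : V} (hv : v ≠ 0) (x : V) :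
    ∃ k : ℤ, |inner ℝ v (x - (k : ℝ) • v)| ≤ ‖v‖ ^ 2 / 2 := by
  have h0 : 0 < ‖v‖ ^ 2 := by have := norm_pos_iff.mpr hv; positivity
  refine ⟨round (inner ℝ v x / ‖v‖ ^ 2), ?_⟩
  have := abs_sub_round (inner ℝ v x / ‖v‖ ^ 2)
  rw [inner_sub_right, inner_smul_right, real_inner_self_eq_norm_sq]
  have e : inner ℝ v x - (round (inner ℝ v x / ‖v‖ ^ 2) : ℝ) * ‖v‖ ^ 2 =
    (inner ℝ v x / ‖v‖ ^ 2 - round (inner ℝ v x / ‖v‖ ^ 2)) * ‖v‖ ^ 2 := by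
    field_simp
  rw [e, abs_mul, abs_of_pos h0]
  nlinarith

/-- Projectivity of the quotient splits off the line through `y`; the functional is the coordinate
along that line. -/
theorem exists_functional_eq_one {M : Type*} [AddCommGroup M] {y : M} [Module.IsTorsionFree ℤ M]
    (hy : y ≠ 0) [Module.Projective ℤ (M ⧸ Submodule.span ℤ {y})] : ∃ ψ : M →ₗ[ℤ] ℤ, ψ y = 1 := by
  set N := Submodule.span ℤ {y} with hN
  obtain ⟨sec, hsec⟩ := Module.projective_lifting_property N.mkQ LinearMap.id N.mkQ_surjective
  have hmem : ∀ m, (LinearMap.id - sec ∘ₗ N.mkQ : M →ₗ[ℤ] M) m ∈ N := fun m => by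
    rw [← Submodule.Quotient.mk_eq_zero, ← Submodule.mkQ_apply, LinearMap.sub_apply, map_sub,
      sub_eq_zero]
    exact (LinearMap.congr_fun hsec (N.mkQ m)).symm
  refine ⟨(LinearEquiv.toSpanNonzeroSingleton ℤ M y hy).symm.toLinearMap ∘ₗ
    (LinearMap.id - sec ∘ₗ N.mkQ).codRestrict N hmem, ?_⟩
  have h1 : N.mkQ y = 0 :=
    (Submodule.Quotient.mk_eq_zero N).mpr (Submodule.mem_span_singleton_self y)
  have h2 : (LinearMap.id - sec ∘ₗ N.mkQ).codRestrict N hmem y =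
      LinearEquiv.toSpanNonzeroSingleton ℤ M y hy 1 := by
    ext
    rw [LinearMap.codRestrict_apply, LinearMap.sub_apply, LinearMap.comp_apply, h1]
    simp
  rw [LinearMap.comp_apply, h2]
  exact LinearEquiv.symm_apply_apply _ _

set_option maxHeartbeats 2000000 in
/-- A transference bound: an additive functional `τ` on a lattice that takes values close to integers
(compared with the norm of the argument) is close to an integral functional. -/
theorem exists_int_functional (n : ℕ) {M : Type*} [AddCommGroup M] [Module.Finite ℤ M]
    [Module.Free ℤ M] (hn : Module.finrank ℤ M = n) (π : M →+ V)
    (hfin : ∀ R : ℝ, {m : M | ‖π m‖ ≤ R}.Finite) (τ : M →+ ℝ) {ε : ℝ} (hε : 0 ≤ ε)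
    (hτ : ∀ m, ∃ k : ℤ, |τ m - k| ≤ ε * ‖π m‖) :
    ∃ (φ : M →+ ℤ) (r : V), (∀ m, τ m - φ m = inner ℝ (π m) r) ∧ ‖r‖ ≤ (2 ^ n - 1) * ε := by
  -- Dividing by a shortest vector and projecting orthogonally to it lowers the rank by one and at
  -- most doubles `ε`. The constants satisfy `c (n + 1) = 1 + 2 * c n` and `c 0 = 0`, hence `2 ^ n -
  -- 1`.
  induction n generalizing M ε with
  | zero =>
    have : Subsingleton M := Module.finrank_zero_iff.mp hn
    refine ⟨0, 0, fun m => ?_, by simp⟩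
    rw [Subsingleton.elim m 0]; simp
  | succ n ih =>
    -- A nonzero kernel element would put infinitely many multiples into the ball of radius `0`.
    have hker : ∀ m, π m = 0 → m = 0 := by
      intro m hm
      by_contra hne
      refine Set.infinite_of_injective_forall_mem
        (f := fun k : ℤ => k • m) (smul_left_injective ℤ hne) (fun k => ?_) (hfin 0)
      simp [hm]
    have : Nontrivial M := Module.nontrivial_of_finrank_pos (R := ℤ) (by omega)
    obtain ⟨y, hy0, hmin⟩ : ∃ y : M, y ≠ 0 ∧ ∀ m, m ≠ 0 → ‖π y‖ ≤ ‖π m‖ := by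
      obtain ⟨a, ha⟩ := exists_ne (0 : M)
      obtain ⟨y, ⟨hy, hy'⟩, h⟩ := Set.exists_min_image {m : M | ‖π m‖ ≤ ‖π a‖ ∧ m ≠ 0}
        (fun m => ‖π m‖) ((hfin _).subset fun m hm => hm.1) ⟨a, le_rfl, ha⟩
      refine ⟨y, hy', fun m hm => ?_⟩
      by_cases hma : ‖π m‖ ≤ ‖π a‖
      · exact h m ⟨hma, hm⟩
      · exact hy.trans (not_le.mp hma).le
    have hv : π y ≠ 0 := fun h => hy0 (hker y h)
    have hvn : 0 < ‖π y‖ := norm_pos_iff.mpr hv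
    set v := π y with hvdef
    have hzs : ∀ (k : ℤ) (m : M), π (k • m) = (k : ℝ) • π m := fun k m => by
      rw [map_zsmul, Int.cast_smul_eq_zsmul]
    -- every class modulo `y` has a size-reduced representative
    have hred : ∀ m : M, ∃ k : ℤ, |inner ℝ v (π (m - k • y))| ≤ ‖v‖ ^ 2 / 2 := fun m => by
      obtain ⟨k, hk⟩ := exists_int_abs_inner_le hv (π m)
      exact ⟨k, by rwa [map_sub, hzs]⟩
    have hlen : ∀ m : M, |inner ℝ v (π m)| ≤ ‖v‖ ^ 2 / 2 →
        ‖π m‖ ^ 2 ≤ ‖projAlong v (π m)‖ ^ 2 + ‖v‖ ^ 2 / 4 := fun m hm => by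
      rw [norm_sq_eq_projAlong hv, add_le_add_iff_left]
      have h1 : |inner ℝ v (π m) / ‖v‖| ≤ ‖v‖ / 2 := by
        rw [abs_div, abs_norm, div_le_iff₀ hvn]; linarith
      have := pow_le_pow_left₀ (abs_nonneg _) h1 2
      rw [sq_abs] at this
      linarith
    set N := Submodule.span ℤ {y} with hN
    -- After size reduction such an element has length at most `‖v‖ / 2`, below the minimum, so it
    -- is a multiple of `y`. This makes the projected map injective on the quotient, which is
    -- therefore torsion free.
    have hproj0 : ∀ m : M, projAlong v (π m) = 0 → m ∈ N := fun m hm => by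
      obtain ⟨k, hk⟩ := hred m
      have h1 := hlen _ hk
      have h2 : projAlong v (π (m - k • y)) = 0 := by
        rw [map_sub, map_sub, hm, hzs, map_smul, ← hvdef, projAlong_self hv]; simp
      rw [h2, norm_zero] at h1
      by_cases h3 : m - k • y = 0
      · rw [sub_eq_zero.mp h3]; exact Submodule.smul_mem _ _ (Submodule.mem_span_singleton_self y)
      · have := pow_le_pow_left₀ hvn.le (hmin _ h3) 2
        nlinarith
    have hNle : N ≤ LinearMap.ker ((projAlong v).toAddMonoidHom.comp π).toIntLinearMap := by
      rw [hN, Submodule.span_singleton_le_iff_mem]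
      exact projAlong_self hv
    set π' : (M ⧸ N) →ₗ[ℤ] V := N.liftQ _ hNle
    have hπ' : ∀ m, π' (N.mkQ m) = projAlong v (π m) := fun m => rfl
    have hπ'inj : ∀ q, π' q = 0 → q = 0 := fun q hq => by
      obtain ⟨m, rfl⟩ := N.mkQ_surjective q
      exact (Submodule.Quotient.mk_eq_zero N).mpr (hproj0 m hq)
    have htf : Module.IsTorsionFree ℤ (M ⧸ N) := .of_smul_eq_zero fun k q hkq => by
      have h1 : (k : ℝ) • π' q = 0 := by
        rw [Int.cast_smul_eq_zsmul, ← map_zsmul, hkq, map_zero]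
      rcases smul_eq_zero.mp h1 with h | h
      · exact .inl (Int.cast_eq_zero.mp h)
      · exact .inr (hπ'inj q h)
    have hfree : Module.Free ℤ (M ⧸ N) := Module.free_of_finite_type_torsion_free'
    have hrank : Module.finrank ℤ (M ⧸ N) = n := by
      have h1 := Submodule.finrank_quotient_add_finrank N
      have h2 : Module.finrank ℤ N = 1 :=
        (LinearEquiv.toSpanNonzeroSingleton ℤ M y hy0).finrank_eq.symm.trans
          (Module.finrank_self ℤ)
      omega
    obtain ⟨ψ, hψy⟩ := exists_functional_eq_one hy0
    obtain ⟨k, hk⟩ := hτ y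
    set δ : ℝ := τ y - k with hδ
    -- the corrected functional, which kills `y`
    set τ₁ : M →+ ℝ := τ - k • ((Int.castAddHom ℝ).comp ψ.toAddMonoidHom) -
      (innerₛₗ ℝ ((δ / ‖v‖ ^ 2) • v)).toAddMonoidHom.comp π with hτ₁
    have hτ₁a : ∀ m, τ₁ m = τ m - k * ψ m - inner ℝ ((δ / ‖v‖ ^ 2) • v) (π m) := fun m => by
      simp [hτ₁, real_inner_smul_left]
    have hτ₁y : τ₁ y = 0 := by
      rw [hτ₁a, hψy, inner_smul_left, ← hvdef, real_inner_self_eq_norm_sq]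
      simp only [conj_trivial]
      field_simp
      simp [hδ]
    have hNle' : N ≤ LinearMap.ker τ₁.toIntLinearMap := by
      rw [hN, Submodule.span_singleton_le_iff_mem]
      exact hτ₁y
    set τ' : (M ⧸ N) →ₗ[ℤ] ℝ := N.liftQ _ hNle'
    have hτ'a : ∀ m, τ' (N.mkQ m) = τ₁ m := fun m => rfl
    have hrep : ∀ q : M ⧸ N, ∃ m : M, N.mkQ m = q ∧ |inner ℝ v (π m)| ≤ ‖v‖ ^ 2 / 2 := fun q => by
      obtain ⟨m, rfl⟩ := N.mkQ_surjective q
      obtain ⟨k, hk⟩ := hred m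
      refine ⟨m - k • y, ?_, hk⟩
      rw [map_sub, sub_eq_self]
      exact (Submodule.Quotient.mk_eq_zero N).mpr
        (Submodule.smul_mem _ _ (Submodule.mem_span_singleton_self y))
    have hfin' : ∀ R : ℝ, {q : M ⧸ N | ‖π' q‖ ≤ R}.Finite := fun R => by
      refine ((hfin (|R| + ‖v‖)).image N.mkQ).subset fun q hq => ?_
      obtain ⟨m, rfl, hm⟩ := hrep q
      refine ⟨m, ?_, rfl⟩
      have h1 := hlen m hm
      have h2 : ‖projAlong v (π m)‖ ≤ |R| := le_trans hq (le_abs_self R)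
      change ‖π m‖ ≤ |R| + ‖v‖
      refine abs_le_of_sq_le_sq' ?_ (by positivity) |>.2
      nlinarith [norm_nonneg (projAlong v (π m)), abs_nonneg R]
    -- On a size-reduced representative the correction along `v` costs at most `ε * ‖π m‖ / 2`,
    -- because `‖v‖ ≤ ‖π m‖`. The total error is `3 / 2 * ε * ‖π m‖`.
    have hτ' : ∀ q, ∃ k : ℤ, |τ' q - k| ≤ (2 * ε) * ‖π' q‖ := fun q => by
      by_cases hq : q = 0
      · exact ⟨0, by simp [hq]⟩
      obtain ⟨m, rfl, hm⟩ := hrep q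
      have hm0 : m ≠ 0 := fun h => hq (by rw [h, map_zero])
      obtain ⟨j, hj⟩ := hτ m
      refine ⟨j - k * ψ m, ?_⟩
      rw [hτ'a, hπ', hτ₁a, inner_smul_left]
      have h1 := hlen m hm
      have h2 := hmin m hm0
      have h3 : |δ / ‖v‖ ^ 2 * inner ℝ v (π m)| ≤ ε * ‖π m‖ / 2 := by
        rw [abs_mul, abs_div, abs_of_pos (by positivity : 0 < ‖v‖ ^ 2), div_mul_eq_mul_div,
          div_le_iff₀ (by positivity)]
        calc |δ| * |inner ℝ v (π m)| ≤ (ε * ‖v‖) * (‖v‖ ^ 2 / 2) :=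
              mul_le_mul hk hm (abs_nonneg _) (by positivity)
          _ ≤ (ε * ‖π m‖) * (‖v‖ ^ 2 / 2) := by gcongr
          _ = _ := by ring
      -- Size reduction and minimality of `v` give `3 / 4 * ‖π m‖ ^ 2 ≤ ‖projAlong v (π m)‖ ^ 2`.
      -- The sharp factor `√3` is rounded up to `2`.
      have h4 : 3 / 2 * ‖π m‖ ≤ 2 * ‖projAlong v (π m)‖ := by
        refine abs_le_of_sq_le_sq' ?_ (by positivity) |>.2
        nlinarith
      have h5 : |(τ m - j) - δ / ‖v‖ ^ 2 * inner ℝ v (π m)| ≤ ε * ‖π m‖ + ε * ‖π m‖ / 2 :=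
        (abs_sub _ _).trans (add_le_add hj h3)
      calc _ = |(τ m - j) - δ / ‖v‖ ^ 2 * inner ℝ v (π m)| := by
            congr 1; push_cast; simp; ring
        _ ≤ ε * (3 / 2 * ‖π m‖) := by linarith
        _ ≤ ε * (2 * ‖projAlong v (π m)‖) := by gcongr
        _ = _ := by ring
    obtain ⟨φ', r', hr', hr'n⟩ := ih hrank π'.toAddMonoidHom hfin' τ'.toAddMonoidHom
      (by positivity) hτ'
    -- `r'` is paired only with projected vectors and the projection is self-adjoint, so `r'` may be
    -- replaced by its own projection.
    refine ⟨k • ψ.toAddMonoidHom + φ'.comp N.mkQ.toAddMonoidHom,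
      (δ / ‖v‖ ^ 2) • v + projAlong v r', fun m => ?_, ?_⟩
    · have h1 : τ₁ m - φ' (N.mkQ m) = inner ℝ (projAlong v (π m)) r' := hr' (N.mkQ m)
      rw [hτ₁a, inner_projAlong] at h1
      rw [inner_add_right, ← h1, real_inner_comm (π m)]
      simp
      ring
    · have h1 : ‖(δ / ‖v‖ ^ 2) • v‖ ≤ ε := by
        rw [norm_smul, norm_div, Real.norm_eq_abs, norm_pow, norm_norm, div_mul_eq_mul_div,
          div_le_iff₀ (by positivity)]
        nlinarith
      refine (norm_add_le _ _).trans ((add_le_add h1 (norm_projAlong_le hv r')).trans ?_)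
      rw [pow_succ]
      linarith

end Transference

/-! ### Families representing a class, and their inverse images -/

section Classes

variable {R : Type*} [CommRing R] {F : Type*} [AddCommGroup F] [Module R F]
  {G : Type*} [AddCommGroup G] [Module R G]

theorem fiberMap_add (σ : R →+* ℂ) (f g : F →ₗ[R] G) :
    fiberMap σ (f + g) = fiberMap σ f + fiberMap σ g :=
  LinearMap.ext fun x => congrArg (fun f : CAt σ ⊗[R] F →ₗ[R] CAt σ ⊗[R] G => f x)
    (LinearMap.lTensor_add (CAt σ) f g)

/-- Only the `G`-component of the splitting has to be compared: the `F`-component is forced by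
`splits`. -/
theorem ArithExtension.isIso_trivialExtension (X : ArithExtension R F G) (ψ : X.E ≃ₗ[R] G × F)
    (hi : ψ.toLinearMap ∘ₗ X.i = LinearMap.inl R G F)
    (hp : LinearMap.snd R G F ∘ₗ ψ.toLinearMap = X.p)
    (T : ∀ σ : R →+* ℂ, Fiber σ F →ₗ[ℂ] Fiber σ G) (hT : ConjInvariant T)
    (h : ∀ σ, T σ = fiberMap σ (LinearMap.fst R G F ∘ₗ ψ.toLinearMap) ∘ₗ X.s σ) :
    X.IsIso (trivialExtension T hT) := by
  refine ⟨ψ, hi, hp, fun σ => ?_⟩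
  have hψ : ψ.toLinearMap = LinearMap.inl R G F ∘ₗ (LinearMap.fst R G F ∘ₗ ψ.toLinearMap) +
      LinearMap.inr R G F ∘ₗ X.p := by
    rw [← hp]; ext x <;> simp
  have hs : fiberMap σ ψ.toLinearMap ∘ₗ X.s σ =
      fiberMap σ (LinearMap.inl R G F) ∘ₗ T σ + fiberMap σ (LinearMap.inr R G F) := by
    conv_lhs => rw [hψ]
    rw [fiberMap_add, fiberMap_comp σ (LinearMap.inl R G F), fiberMap_comp σ _ X.p,
      LinearMap.add_comp, LinearMap.comp_assoc, LinearMap.comp_assoc, ← h, X.splits,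
      LinearMap.comp_id]
  exact hs

/-- If `F` is projective, every class of arithmetic extensions is in the image of `b`. -/
theorem exists_classOf_eq [Module.Projective R F] (e : ArithExt R F G) :
    ∃ (T : ∀ σ : R →+* ℂ, Fiber σ F →ₗ[ℂ] Fiber σ G) (hT : ConjInvariant T),
      classOf T hT = e := by
  obtain ⟨X, rfl⟩ := Quotient.exists_rep e
  obtain ⟨q, hq⟩ := Module.projective_lifting_property X.p LinearMap.id X.surjective
  obtain ⟨ψ, hi, hp⟩ := X.exact.splitSurjectiveEquiv X.injective ⟨q, hq⟩
  refine ⟨fun σ => fiberMap σ (LinearMap.fst R G F ∘ₗ ψ.toLinearMap) ∘ₗ X.s σ, fun σ x => ?_,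
    Eq.symm (Quotient.sound (X.isIso_trivialExtension ψ ?_ hp.symm _ _ fun σ => rfl))⟩
  · simp only [LinearMap.comp_apply, X.conj_invariant σ x, fiberMap_conj]
  · rw [hi]; ext <;> simp

/-- The automorphisms of `G × F` inducing the identity on both ends are the shears `(g, f) ↦ (g + u
f, f)`, and a shear translates `T` by `u`. -/
theorem classOf_eq_iff {T T' : ∀ σ : R →+* ℂ, Fiber σ F →ₗ[ℂ] Fiber σ G} (hT : ConjInvariant T)
    (hT' : ConjInvariant T') :
    classOf T hT = classOf T' hT' ↔ ∃ u : F →ₗ[R] G, ∀ σ, T' σ = T σ + fiberMap σ u := by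
  constructor
  · intro h
    obtain ⟨φ, hi, -, hs⟩ : ∃ φ : (G × F) ≃ₗ[R] G × F,
        φ.toLinearMap ∘ₗ LinearMap.inl R G F = LinearMap.inl R G F ∧
        LinearMap.snd R G F ∘ₗ φ.toLinearMap = LinearMap.snd R G F ∧
        ∀ σ, fiberMap σ φ.toLinearMap ∘ₗ
          (fiberMap σ (LinearMap.inl R G F) ∘ₗ T σ + fiberMap σ (LinearMap.inr R G F)) =
          fiberMap σ (LinearMap.inl R G F) ∘ₗ T' σ + fiberMap σ (LinearMap.inr R G F) :=
      Quotient.exact h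
    refine ⟨LinearMap.fst R G F ∘ₗ φ.toLinearMap ∘ₗ LinearMap.inr R G F, fun σ => ?_⟩
    have h1 := congrArg (fun f => fiberMap σ (LinearMap.fst R G F) ∘ₗ f) (hs σ)
    simp only [LinearMap.comp_add, ← LinearMap.comp_assoc, ← fiberMap_comp] at h1
    rw [LinearMap.comp_assoc _ φ.toLinearMap, hi, LinearMap.fst_comp_inl, LinearMap.fst_comp_inr,
      fiberMap_id, fiberMap_zero, LinearMap.id_comp, LinearMap.id_comp, add_zero] at h1
    exact h1.symm
  · rintro ⟨u, hu⟩
    let ψ : (G × F) ≃ₗ[R] G × F :=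
      { toFun := fun x => (x.1 + u x.2, x.2)
        invFun := fun x => (x.1 - u x.2, x.2)
        map_add' := fun x y => by ext <;> simp; abel
        map_smul' := fun r x => by ext <;> simp
        left_inv := fun x => by simp
        right_inv := fun x => by simp }
    have h1 : LinearMap.fst R G F ∘ₗ ψ.toLinearMap =
        LinearMap.fst R G F + u ∘ₗ LinearMap.snd R G F := rfl
    refine Quotient.sound ((trivialExtension T hT).isIso_trivialExtension ψ ?_ rfl _ _ fun σ => ?_)
    · ext x
      · change x + u 0 = x; simp
      · rfl
    · change T' σ = fiberMap σ (LinearMap.fst R G F ∘ₗ ψ.toLinearMap) ∘ₗ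
        (fiberMap σ (LinearMap.inl R G F) ∘ₗ T σ + fiberMap σ (LinearMap.inr R G F))
      rw [hu, h1, LinearMap.comp_add, ← LinearMap.comp_assoc, ← fiberMap_comp, ← fiberMap_comp,
        LinearMap.add_comp, LinearMap.add_comp, LinearMap.fst_comp_inl, LinearMap.fst_comp_inr,
        LinearMap.comp_assoc, LinearMap.comp_assoc, LinearMap.snd_comp_inl, LinearMap.snd_comp_inr,
        LinearMap.comp_zero, add_zero, zero_add, fiberMap_id]
      rfl

end Classes

section ClassesBaseChange

variable {R : Type*} [CommRing R] {R' : Type*} [CommRing R'] [Algebra R R']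
  {F : Type*} [AddCommGroup F] [Module R F] {G : Type*} [AddCommGroup G] [Module R G]

/-- The inverse image of a family of linear maps `T_σ : F_σ → G_σ`. -/
noncomputable def familyBaseChange (T : ∀ σ : R →+* ℂ, Fiber σ F →ₗ[ℂ] Fiber σ G)
    (τ : R' →+* ℂ) : Fiber τ (R' ⊗[R] F) →ₗ[ℂ] Fiber τ (R' ⊗[R] G) :=
  (fiberBaseChange τ G).symm.toLinearMap ∘ₗ T (τ.comp (algebraMap R R')) ∘ₗ
    (fiberBaseChange τ F).toLinearMap

theorem ConjInvariant.familyBaseChange {T : ∀ σ : R →+* ℂ, Fiber σ F →ₗ[ℂ] Fiber σ G}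
    (hT : ConjInvariant T) : ConjInvariant (familyBaseChange (R' := R') T) := fun τ x => by
  simp only [Arakelov.familyBaseChange, LinearMap.comp_apply, LinearEquiv.coe_coe]
  rw [fiberBaseChange_conj, ← fiberBaseChange_symm_conj]
  exact congrArg _ (hT (τ.comp (algebraMap R R')) (fiberBaseChange τ F x))

/-- The isomorphism is distributivity of the tensor product over `G × F`. -/
theorem baseChange_classOf [Module.Flat R R'] {T : ∀ σ : R →+* ℂ, Fiber σ F →ₗ[ℂ] Fiber σ G}
    (hT : ConjInvariant T) :
    (classOf T hT).baseChange R' = classOf (familyBaseChange (R' := R') T)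
      hT.familyBaseChange := by
  let ψ := TensorProduct.prodRight R R' R' G F
  have h1 : LinearMap.fst R' (R' ⊗[R] G) (R' ⊗[R] F) ∘ₗ ψ.toLinearMap =
      (LinearMap.fst R G F).baseChange R' := by
    ext <;> simp [ψ]
  have h2 : ψ.toLinearMap ∘ₗ (LinearMap.inl R G F).baseChange R' =
      LinearMap.inl R' (R' ⊗[R] G) (R' ⊗[R] F) := by
    ext <;> simp [ψ]
  have h3 : LinearMap.snd R' (R' ⊗[R] G) (R' ⊗[R] F) ∘ₗ ψ.toLinearMap =
      (LinearMap.snd R G F).baseChange R' := by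
    ext <;> simp [ψ]
  refine Quotient.sound (((trivialExtension T hT).baseChange R').isIso_trivialExtension
    ψ h2 h3 _ _ fun τ => ?_)
  have h4 : fiberMap τ (LinearMap.fst R' (R' ⊗[R] G) (R' ⊗[R] F) ∘ₗ ψ.toLinearMap) =
    fiberMap τ ((LinearMap.fst R G F).baseChange R') := congrArg _ h1
  refine LinearMap.ext fun x => ?_
  refine Eq.trans ?_ (LinearMap.congr_fun h4 ((fiberBaseChange τ (G × F)).symm
    ((trivialExtension T hT).s (τ.comp (algebraMap R R')) (fiberBaseChange τ F x)))).symm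
  refine Eq.trans ?_ (fiberMap_fiberBaseChange_symm τ (LinearMap.fst R G F) _).symm
  refine congrArg (fiberBaseChange τ G).symm ?_
  set σ := τ.comp (algebraMap R R')
  change T σ _ = (fiberMap σ (LinearMap.fst R G F) ∘ₗ
    (fiberMap σ (LinearMap.inl R G F) ∘ₗ T σ + fiberMap σ (LinearMap.inr R G F))) _
  rw [LinearMap.comp_add, ← LinearMap.comp_assoc, ← fiberMap_comp, ← fiberMap_comp,
    LinearMap.fst_comp_inl, LinearMap.fst_comp_inr, fiberMap_id, fiberMap_zero, add_zero]
  rfl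

end ClassesBaseChange

/-! ### The Hilbert-Schmidt scalar product and Cauchy-Schwarz -/

section HilbertSchmidt

variable {V W : Type*} [AddCommGroup V] [Module ℂ V] [Module.Finite ℂ V]
  [AddCommGroup W] [Module ℂ W] [Module.Finite ℂ W]
  (cV : InnerProductSpace.Core ℂ V) (cW : InnerProductSpace.Core ℂ W)

/-- The adjoint of a linear map with respect to hermitian scalar products. -/
noncomputable def coreAdjoint (T : V →ₗ[ℂ] W) : W →ₗ[ℂ] V :=
  letI : NormedAddCommGroup V := cV.toNormedAddCommGroup
  letI : InnerProductSpace ℂ V := InnerProductSpace.ofCore cV.toCore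
  letI : NormedAddCommGroup W := cW.toNormedAddCommGroup
  letI : InnerProductSpace ℂ W := InnerProductSpace.ofCore cW.toCore
  LinearMap.adjoint T

theorem hsNormSq_eq (T : V →ₗ[ℂ] W) :
    hsNormSq cV cW T = (LinearMap.trace ℂ V (coreAdjoint cV cW T ∘ₗ T)).re := rfl

theorem inner_coreAdjoint (T : V →ₗ[ℂ] W) (w : W) (v : V) :
    cV.inner (coreAdjoint cV cW T w) v = cW.inner w (T v) :=
  letI : NormedAddCommGroup V := cV.toNormedAddCommGroup
  letI : InnerProductSpace ℂ V := InnerProductSpace.ofCore cV.toCore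
  letI : NormedAddCommGroup W := cW.toNormedAddCommGroup
  letI : InnerProductSpace ℂ W := InnerProductSpace.ofCore cW.toCore
  LinearMap.adjoint_inner_left T v w

theorem eq_coreAdjoint {T : V →ₗ[ℂ] W} {A : W →ₗ[ℂ] V}
    (h : ∀ w v, cV.inner (A w) v = cW.inner w (T v)) : A = coreAdjoint cV cW T :=
  letI : NormedAddCommGroup V := cV.toNormedAddCommGroup
  letI : InnerProductSpace ℂ V := InnerProductSpace.ofCore cV.toCore
  letI : NormedAddCommGroup W := cW.toNormedAddCommGroup
  letI : InnerProductSpace ℂ W := InnerProductSpace.ofCore cW.toCore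
  (LinearMap.eq_adjoint_iff A T).mpr h

theorem coreAdjoint_coreAdjoint (T : V →ₗ[ℂ] W) :
    coreAdjoint cW cV (coreAdjoint cV cW T) = T :=
  (eq_coreAdjoint cW cV fun v w => by
    rw [← cW.conj_inner_symm, ← inner_coreAdjoint, cV.conj_inner_symm]).symm

theorem coreAdjoint_add (S T : V →ₗ[ℂ] W) :
    coreAdjoint cV cW (S + T) = coreAdjoint cV cW S + coreAdjoint cV cW T :=
  letI : NormedAddCommGroup V := cV.toNormedAddCommGroup
  letI : InnerProductSpace ℂ V := InnerProductSpace.ofCore cV.toCore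
  letI : NormedAddCommGroup W := cW.toNormedAddCommGroup
  letI : InnerProductSpace ℂ W := InnerProductSpace.ofCore cW.toCore
  map_add LinearMap.adjoint S T

theorem coreAdjoint_smul (r : ℂ) (T : V →ₗ[ℂ] W) :
    coreAdjoint cV cW (r • T) = conj r • coreAdjoint cV cW T :=
  letI : NormedAddCommGroup V := cV.toNormedAddCommGroup
  letI : InnerProductSpace ℂ V := InnerProductSpace.ofCore cV.toCore
  letI : NormedAddCommGroup W := cW.toNormedAddCommGroup
  letI : InnerProductSpace ℂ W := InnerProductSpace.ofCore cW.toCore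
  LinearMap.adjoint.map_smulₛₗ r T

theorem trace_coreAdjoint_comp (S T : V →ₗ[ℂ] W) :
    conj (LinearMap.trace ℂ V (coreAdjoint cV cW T ∘ₗ S)) =
      LinearMap.trace ℂ V (coreAdjoint cV cW S ∘ₗ T) := by
  let _ : NormedAddCommGroup V := cV.toNormedAddCommGroup
  let _ : InnerProductSpace ℂ V := InnerProductSpace.ofCore cV.toCore
  let _ : NormedAddCommGroup W := cW.toNormedAddCommGroup
  let _ : InnerProductSpace ℂ W := InnerProductSpace.ofCore cW.toCore
  change conj (LinearMap.trace ℂ V (LinearMap.adjoint T ∘ₗ S)) =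
      LinearMap.trace ℂ V (LinearMap.adjoint S ∘ₗ T)
  rw [LinearMap.trace_eq_sum_inner _ (stdOrthonormalBasis ℂ V),
    LinearMap.trace_eq_sum_inner _ (stdOrthonormalBasis ℂ V), map_sum]
  refine Finset.sum_congr rfl fun i _ => ?_
  rw [inner_conj_symm, LinearMap.comp_apply, LinearMap.comp_apply, LinearMap.adjoint_inner_left,
    LinearMap.adjoint_inner_right]

/-- In an orthonormal basis `e i` the trace is the sum of the `‖T (e i)‖ ^ 2`. -/
theorem trace_coreAdjoint_comp_self (T : V →ₗ[ℂ] W) :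
    0 ≤ (LinearMap.trace ℂ V (coreAdjoint cV cW T ∘ₗ T)).re ∧
      (LinearMap.trace ℂ V (coreAdjoint cV cW T ∘ₗ T) = 0 → T = 0) := by
  let _ : NormedAddCommGroup V := cV.toNormedAddCommGroup
  let _ : InnerProductSpace ℂ V := InnerProductSpace.ofCore cV.toCore
  let _ : NormedAddCommGroup W := cW.toNormedAddCommGroup
  let _ : InnerProductSpace ℂ W := InnerProductSpace.ofCore cW.toCore
  have h : (LinearMap.trace ℂ V (LinearMap.adjoint T ∘ₗ T)) =
      ((∑ i, ‖T (stdOrthonormalBasis ℂ V i)‖ ^ 2 : ℝ) : ℂ) := by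
    rw [LinearMap.trace_eq_sum_inner _ (stdOrthonormalBasis ℂ V)]
    push_cast
    refine Finset.sum_congr rfl fun i _ => ?_
    exact (LinearMap.adjoint_inner_right T _ _).trans (inner_self_eq_norm_sq_to_K _)
  change 0 ≤ (LinearMap.trace ℂ V (LinearMap.adjoint T ∘ₗ T)).re ∧
      (LinearMap.trace ℂ V (LinearMap.adjoint T ∘ₗ T) = 0 → T = 0)
  rw [h]
  refine ⟨by rw [Complex.ofReal_re]; positivity, fun h0 => ?_⟩
  rw [Complex.ofReal_eq_zero, Finset.sum_eq_zero_iff_of_nonneg (by intros; positivity)] at h0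
  refine (stdOrthonormalBasis ℂ V).toBasis.ext fun i => ?_
  have := h0 i (Finset.mem_univ i)
  rw [OrthonormalBasis.coe_toBasis]
  simpa using this

/-- The Hilbert-Schmidt scalar product. -/
@[reducible] noncomputable def hsCore : InnerProductSpace.Core ℂ (V →ₗ[ℂ] W) where
  inner S T := LinearMap.trace ℂ V (coreAdjoint cV cW S ∘ₗ T)
  conj_inner_symm S T := trace_coreAdjoint_comp cV cW S T
  re_inner_nonneg T := (trace_coreAdjoint_comp_self cV cW T).1
  add_left S T U := by rw [coreAdjoint_add, LinearMap.add_comp, map_add]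
  smul_left S T r := by rw [coreAdjoint_smul, LinearMap.smul_comp, map_smul, smul_eq_mul]
  definite T := (trace_coreAdjoint_comp_self cV cW T).2

theorem hsNormSq_nonneg (T : V →ₗ[ℂ] W) : 0 ≤ hsNormSq cV cW T :=
  (hsCore cV cW).re_inner_nonneg T

theorem hsNormSq_coreAdjoint (T : V →ₗ[ℂ] W) :
    hsNormSq cW cV (coreAdjoint cV cW T) = hsNormSq cV cW T := by
  rw [hsNormSq_eq, hsNormSq_eq, coreAdjoint_coreAdjoint, LinearMap.trace_comp_comm']

/-- The Cauchy-Schwarz inequality for the trace pairing. -/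
theorem norm_trace_comp_sq_le (Y : W →ₗ[ℂ] V) (T : V →ₗ[ℂ] W) :
    ‖LinearMap.trace ℂ V (Y ∘ₗ T)‖ ^ 2 ≤ hsNormSq cW cV Y * hsNormSq cV cW T := by
  let _ : NormedAddCommGroup (V →ₗ[ℂ] W) := (hsCore cV cW).toNormedAddCommGroup
  let _ : InnerProductSpace ℂ (V →ₗ[ℂ] W) := InnerProductSpace.ofCore (hsCore cV cW).toCore
  have hn : ∀ S : V →ₗ[ℂ] W, ‖S‖ ^ 2 = hsNormSq cV cW S := fun S =>
    (inner_self_eq_norm_sq (𝕜 := ℂ) S).symm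
  have h : ‖LinearMap.trace ℂ V (coreAdjoint cV cW (coreAdjoint cW cV Y) ∘ₗ T)‖ ≤
    ‖coreAdjoint cW cV Y‖ * ‖T‖ := norm_inner_le_norm (𝕜 := ℂ) (coreAdjoint cW cV Y) T
  rw [coreAdjoint_coreAdjoint] at h
  have h2 := pow_le_pow_left₀ (norm_nonneg _) h 2
  rwa [mul_pow, hn, hn, hsNormSq_coreAdjoint] at h2

/-- Isometries carry adjoints to adjoints, and the trace is invariant under conjugation. -/
theorem hsNormSq_conj {V' W' : Type*} [AddCommGroup V'] [Module ℂ V'] [Module.Finite ℂ V']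
    [AddCommGroup W'] [Module ℂ W'] [Module.Finite ℂ W'] (cV' : InnerProductSpace.Core ℂ V')
    (cW' : InnerProductSpace.Core ℂ W') (α : V ≃ₗ[ℂ] V') (β : W ≃ₗ[ℂ] W')
    (hα : ∀ x y, cV'.inner (α x) (α y) = cV.inner x y)
    (hβ : ∀ x y, cW'.inner (β x) (β y) = cW.inner x y) (T : V' →ₗ[ℂ] W') :
    hsNormSq cV cW (β.symm.toLinearMap ∘ₗ T ∘ₗ α.toLinearMap) = hsNormSq cV' cW' T := by
  have h : α.symm.toLinearMap ∘ₗ coreAdjoint cV' cW' T ∘ₗ β.toLinearMap =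
      coreAdjoint cV cW (β.symm.toLinearMap ∘ₗ T ∘ₗ α.toLinearMap) := by
    refine eq_coreAdjoint cV cW fun w v => ?_
    simp only [LinearMap.comp_apply, LinearEquiv.coe_coe]
    rw [← hα, ← hβ, LinearEquiv.apply_symm_apply, LinearEquiv.apply_symm_apply, inner_coreAdjoint]
  rw [hsNormSq_eq, hsNormSq_eq, ← h, ← LinearMap.trace_conj' _ α.symm]
  congr 2
  ext x
  simp [LinearEquiv.conj_apply]

end HilbertSchmidt

/-! ### The trace pairing, bases of fibres, and base change -/

section Elementary

variable {R M N ι κ : Type*} [CommRing R] [AddCommGroup M] [Module R M] [AddCommGroup N]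
  [Module R N] (b : Module.Basis ι R M) (c : Module.Basis κ R N)

/-- The elementary linear map that sends `b j` to `c i` and the other basis vectors to zero. -/
noncomputable def elemMap (j : ι) (i : κ) : M →ₗ[R] N := (b.coord j).smulRight (c i)

theorem elemMap_apply (j : ι) (i : κ) (x : M) : elemMap b c j i x = b.repr x j • c i := rfl

theorem eq_sum_elemMap [Fintype ι] [Fintype κ] (S : M →ₗ[R] N) :
    S = ∑ j, ∑ i, c.repr (S (b j)) i • elemMap b c j i := by
  classical
  refine b.ext fun k => ?_
  simp only [LinearMap.sum_apply, LinearMap.smul_apply, elemMap_apply, b.repr_self,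
    Finsupp.single_apply]
  rw [Finset.sum_eq_single k]
  · simp [c.sum_repr]
  · intro j _ hj
    simp [Ne.symm hj]
  · simp

/-- The trace pairing reads off matrix entries, so the elementary maps in the two directions form
dual bases. -/
theorem trace_comp_elemMap [Finite ι] (S : N →ₗ[R] M) (j : ι) (i : κ) :
    LinearMap.trace R M (S ∘ₗ elemMap b c j i) = b.repr (S (c i)) j := by
  have : Module.Free R M := Module.Free.of_basis b
  have : Module.Finite R M := Module.Finite.of_basis b
  have h : S ∘ₗ elemMap b c j i = (b.coord j).smulRight (S (c i)) := by
    ext x; simp [elemMap_apply]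
  rw [h, LinearMap.trace_smulRight, Module.Basis.coord_apply]

theorem trace_comp_eq_sum [Fintype ι] [Fintype κ] (S : N →ₗ[R] M) (u : M →ₗ[R] N) :
    LinearMap.trace R M (S ∘ₗ u) =
      ∑ i, ∑ j, b.repr (S (c i)) j * LinearMap.trace R M (elemMap c b i j ∘ₗ u) := by
  refine (congrArg (LinearMap.trace R M ∘ₗ LinearMap.lcomp R M u)
    (eq_sum_elemMap c b S)).trans ?_
  simp only [map_sum, map_smul, smul_eq_mul]
  rfl

/-- The trace pairing is perfect. -/
theorem exists_trace_comp_eq [Module.Finite R M] [Module.Free R M] [Module.Finite R N]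
    [Module.Free R N] (φ : (N →ₗ[R] M) →ₗ[R] R) :
    ∃ u : M →ₗ[R] N, ∀ y, LinearMap.trace R M (y ∘ₗ u) = φ y := by
  let b := Module.Free.chooseBasis R M
  let c := Module.Free.chooseBasis R N
  refine ⟨∑ i, ∑ j, φ (elemMap c b i j) • elemMap b c j i, fun y => ?_⟩
  conv_rhs => rw [eq_sum_elemMap c b y]
  change (LinearMap.trace R M ∘ₗ LinearMap.compRight R y) _ = _
  simp only [map_sum, map_smul, smul_eq_mul]
  refine Finset.sum_congr rfl fun i _ => Finset.sum_congr rfl fun j _ => ?_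
  rw [← trace_comp_elemMap b c y, mul_comm]
  rfl

end Elementary

section FiberBasis

variable {R : Type*} [CommRing R] (σ : R →+* ℂ) {M N : Type*} [AddCommGroup M] [Module R M]
  [AddCommGroup N] [Module R N] {ι κ : Type*} (b : Module.Basis ι R M) (c : Module.Basis κ R N)

/-- The basis of a complex fibre induced by a basis of the module. -/
noncomputable def fiberBasis : Module.Basis ι ℂ (Fiber σ M) :=
  show Module.Basis ι (CAt σ) (CAt σ ⊗[R] M) from Algebra.TensorProduct.basis (CAt σ) b

theorem fiberBasis_apply (i : ι) : fiberBasis σ b i = (1 : CAt σ) ⊗ₜ[R] b i :=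
  Algebra.TensorProduct.basis_apply b i

theorem fiberBasis_repr_tmul (z : CAt σ) (m : M) (i : ι) :
    (fiberBasis σ b).repr (z ⊗ₜ[R] m) i = (show ℂ from z) * σ (b.repr m i) :=
  congrArg (fun f => f i) (Algebra.TensorProduct.basis_repr_tmul b z m)

theorem fiberBasis_repr_conj (x : Fiber σ M) (i : ι) :
    (fiberBasis (conjEmb σ) b).repr (fiberConj σ M x) i =
      conj ((fiberBasis σ b).repr x i) := by
  induction x using TensorProduct.induction_on with
  | zero => simp
  | tmul z m =>
    rw [fiberConj_tmul, fiberBasis_repr_tmul, fiberBasis_repr_tmul, map_mul]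
    rfl
  | add x y hx hy =>
    rw [map_add, map_add, map_add, Finsupp.add_apply, Finsupp.add_apply, hx, hy, map_add]

theorem fiberConj_fiberBasis (i : ι) :
    fiberConj σ M (fiberBasis σ b i) = fiberBasis (conjEmb σ) b i := by
  rw [fiberBasis_apply, fiberBasis_apply, fiberConj_tmul]
  exact congrArg (· ⊗ₜ[R] b i) (map_one (starRingEnd ℂ))

theorem fiberMap_elemMap (j : ι) (i : κ) :
    fiberMap σ (elemMap b c j i) = elemMap (fiberBasis σ b) (fiberBasis σ c) j i := by
  classical
  refine (fiberBasis σ b).ext fun k => ?_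
  rw [elemMap_apply (fiberBasis σ b), Module.Basis.repr_self, fiberBasis_apply, fiberMap_tmul,
    elemMap_apply, b.repr_self, fiberBasis_apply, Finsupp.single_apply, Finsupp.single_apply]
  split_ifs <;> simp

theorem trace_fiberMap [Module.Finite R M] [Module.Free R M] (f : M →ₗ[R] M) :
    LinearMap.trace ℂ (Fiber σ M) (fiberMap σ f) = σ (LinearMap.trace R M f) :=
  LinearMap.trace_baseChange f (CAt σ)

end FiberBasis

section BaseChangeNorm

variable {R : Type*} [CommRing R] {R' : Type*} [CommRing R'] [Algebra R R'] (τ : R' →+* ℂ)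
  {F : Type*} [AddCommGroup F] [Module R F] {G : Type*} [AddCommGroup G] [Module R G]

theorem fiberMap_baseChange (f : F →ₗ[R] G) :
    fiberMap τ (f.baseChange R') = familyBaseChange (fun σ => fiberMap σ f) τ := by
  refine LinearMap.ext fun x => ?_
  obtain ⟨y, rfl⟩ := (fiberBaseChange τ F).symm.surjective x
  rw [fiberMap_fiberBaseChange_symm]
  exact congrArg (fun z => (fiberBaseChange τ G).symm (fiberMap _ f z))
    (LinearEquiv.apply_symm_apply _ y).symm

theorem hsNormSq_familyBaseChange [Module.Finite R F] [Module.Finite R G]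
    (hF : HermitianMetric R F) (hG : HermitianMetric R G)
    (T : ∀ σ : R →+* ℂ, Fiber σ F →ₗ[ℂ] Fiber σ G) :
    hsNormSq ((hF.baseChange R').core τ) ((hG.baseChange R').core τ) (familyBaseChange T τ) =
      hsNormSq (hF.core (τ.comp (algebraMap R R'))) (hG.core (τ.comp (algebraMap R R')))
        (T (τ.comp (algebraMap R R'))) :=
  hsNormSq_conj _ _ _ _ (fiberBaseChange τ F) (fiberBaseChange τ G) (fun _ _ => rfl)
    (fun _ _ => rfl) _

theorem trace_familyBaseChange_comp (S : ∀ σ : R →+* ℂ, Fiber σ G →ₗ[ℂ] Fiber σ F)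
    (T : ∀ σ : R →+* ℂ, Fiber σ F →ₗ[ℂ] Fiber σ G) :
    LinearMap.trace ℂ _ (familyBaseChange S τ ∘ₗ familyBaseChange T τ) =
      LinearMap.trace ℂ _ (S (τ.comp (algebraMap R R')) ∘ₗ T (τ.comp (algebraMap R R'))) := by
  rw [← LinearMap.trace_conj' _ (fiberBaseChange τ F)]
  congr 1
  refine LinearMap.ext fun x => ?_
  simp only [LinearEquiv.conj_apply, familyBaseChange, LinearMap.comp_apply, LinearEquiv.coe_coe]
  rw [LinearEquiv.apply_symm_apply, LinearEquiv.apply_symm_apply, LinearEquiv.apply_symm_apply]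

end BaseChangeNorm

/-! ### Real structures on the fibre over `ℤ` -/

section Real

variable {F : Type*} [AddCommGroup F] {G : Type*} [AddCommGroup G]
  {ι κ : Type*} (b : Module.Basis ι ℤ F) (c : Module.Basis κ ℤ G)

theorem intEmb_eq (σ ρ : ℤ →+* ℂ) : σ = ρ := Subsingleton.elim σ ρ

/-- The only embedding of `ℤ` is its own conjugate, so invariance becomes reality of the matrix
entries. -/
theorem ConjInvariant.conj_repr {T : ∀ σ : ℤ →+* ℂ, Fiber σ F →ₗ[ℂ] Fiber σ G}
    (hT : ConjInvariant T) (σ : ℤ →+* ℂ) (j : ι) (i : κ) :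
    conj ((fiberBasis σ c).repr (T σ (fiberBasis σ b j)) i) =
      (fiberBasis σ c).repr (T σ (fiberBasis σ b j)) i := by
  rw [← fiberBasis_repr_conj, ← hT, fiberConj_fiberBasis]
  exact congrArg (fun ρ => (fiberBasis ρ c).repr (T ρ (fiberBasis ρ b j)) i) (intEmb_eq _ _)

theorem HermitianMetric.conj_inner_fiberBasis (h : HermitianMetric ℤ F) (σ : ℤ →+* ℂ) (i j : ι) :
    conj ((h.core σ).inner (fiberBasis σ b i) (fiberBasis σ b j)) =
      (h.core σ).inner (fiberBasis σ b i) (fiberBasis σ b j) := by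
  rw [← h.conj_invariant, fiberConj_fiberBasis, fiberConj_fiberBasis]
  exact congrArg (fun ρ => (h.core ρ).inner (fiberBasis ρ b i) (fiberBasis ρ b j)) (intEmb_eq _ _)

end Real

section CoreSum

variable {V : Type*} [AddCommGroup V] [Module ℂ V] (cV : InnerProductSpace.Core ℂ V)

theorem core_sum_left {α : Type*} (s : Finset α) (z : α → ℂ) (v : α → V) (w : V) :
    cV.inner (∑ i ∈ s, z i • v i) w = ∑ i ∈ s, conj (z i) * cV.inner (v i) w := by
  let _ : NormedAddCommGroup V := cV.toNormedAddCommGroup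
  let _ : InnerProductSpace ℂ V := InnerProductSpace.ofCore cV.toCore
  change inner ℂ (∑ i ∈ s, z i • v i) w = ∑ i ∈ s, conj (z i) * inner ℂ (v i) w
  simp [mul_comm]

theorem core_sum_right {α : Type*} (s : Finset α) (z : α → ℂ) (v : α → V) (w : V) :
    cV.inner w (∑ i ∈ s, z i • v i) = ∑ i ∈ s, z i * cV.inner w (v i) := by
  let _ : NormedAddCommGroup V := cV.toNormedAddCommGroup
  let _ : InnerProductSpace ℂ V := InnerProductSpace.ofCore cV.toCore
  change inner ℂ w (∑ i ∈ s, z i • v i) = ∑ i ∈ s, z i * inner ℂ w (v i)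
  simp

/-- With respect to a basis with real Gram matrix, a vector whose scalar products with the basis
vectors are real has real coordinates. -/
theorem conj_repr_of_conj_inner {ι : Type*} [Fintype ι] (b : Module.Basis ι ℂ V)
    (hb : ∀ i j, conj (cV.inner (b i) (b j)) = cV.inner (b i) (b j)) {v : V}
    (hv : ∀ j, conj (cV.inner v (b j)) = cV.inner v (b j)) (i : ι) :
    conj (b.repr v i) = b.repr v i := by
  -- Since the Gram matrix is real, `w` has the same scalar products with the basis as `v`;
  -- definiteness then gives `w = v`.
  set w : V := ∑ i, conj (b.repr v i) • b i with hw
  have h1 : ∀ j, cV.inner (w - v) (b j) = 0 := fun j => by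
    rw [sub_eq_add_neg, cV.add_left, ← neg_one_smul ℂ v, cV.smul_left, hw, core_sum_left]
    have h2 := hv j
    conv_lhs at h2 => rw [← b.sum_repr v, core_sum_left, map_sum]
    simp only [map_mul, Complex.conj_conj, hb] at h2
    simp only [Complex.conj_conj, h2]
    simp
  have h3 : w - v = 0 := cV.definite _ <| by
    conv_lhs => rw [← b.sum_repr (w - v), core_sum_right, b.sum_repr]
    simp [h1]
  have h4 := congrArg (fun x => (b.repr x : ι → ℂ) i) (sub_eq_zero.mp h3)
  rwa [hw, b.repr_sum_self] at h4

end CoreSum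

section RealCoordinates

variable {V W : Type*} [AddCommGroup V] [Module ℂ V] [Module.Finite ℂ V]
  [AddCommGroup W] [Module ℂ W] [Module.Finite ℂ W]
  (cV : InnerProductSpace.Core ℂ V) (cW : InnerProductSpace.Core ℂ W)
  {ι κ : Type*} [Fintype ι] (b : Module.Basis ι ℂ V) (c : Module.Basis κ ℂ W)

/-- It exhibits the adjoint of a real map as a real combination of integral maps in the other
direction, as `re_trace_comp_congr` requires. -/
theorem conj_repr_coreAdjoint [Fintype κ]
    (hb : ∀ i j, conj (cV.inner (b i) (b j)) = cV.inner (b i) (b j))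
    (hc : ∀ i j, conj (cW.inner (c i) (c j)) = cW.inner (c i) (c j)) {T : V →ₗ[ℂ] W}
    (hT : ∀ j i, conj (c.repr (T (b j)) i) = c.repr (T (b j)) i) (i : κ) (j : ι) :
    conj (b.repr (coreAdjoint cV cW T (c i)) j) = b.repr (coreAdjoint cV cW T (c i)) j := by
  refine conj_repr_of_conj_inner cV b hb (fun k => ?_) j
  rw [inner_coreAdjoint, ← c.sum_repr (T (b k)), core_sum_right, map_sum]
  simp only [map_mul, hT, hc]

end RealCoordinates

section RealCombination

variable {F : Type*} [AddCommGroup F] {G : Type*} [AddCommGroup G]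

/-- A real linear combination of maps `y_σ` is determined under the trace pairing by the values on
the maps `y_σ`. -/
theorem re_trace_comp_congr {ι κ : Type*} [Fintype ι] [Fintype κ] (b : Module.Basis ι ℤ F)
    (c : Module.Basis κ ℤ G) (σ : ℤ →+* ℂ) {A : Fiber σ G →ₗ[ℂ] Fiber σ F}
    (hA : ∀ i j, conj ((fiberBasis σ b).repr (A (fiberBasis σ c i)) j) =
      (fiberBasis σ b).repr (A (fiberBasis σ c i)) j) {X Y : Fiber σ F →ₗ[ℂ] Fiber σ G}
    (h : ∀ y : G →ₗ[ℤ] F, (LinearMap.trace ℂ _ (fiberMap σ y ∘ₗ X)).re =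
      (LinearMap.trace ℂ _ (fiberMap σ y ∘ₗ Y)).re) :
    (LinearMap.trace ℂ _ (A ∘ₗ X)).re = (LinearMap.trace ℂ _ (A ∘ₗ Y)).re := by
  have key : ∀ Z : Fiber σ F →ₗ[ℂ] Fiber σ G, (LinearMap.trace ℂ _ (A ∘ₗ Z)).re =
      ∑ i, ∑ j, ((fiberBasis σ b).repr (A (fiberBasis σ c i)) j).re *
        (LinearMap.trace ℂ _ (fiberMap σ (elemMap c b i j) ∘ₗ Z)).re := fun Z => by
    rw [trace_comp_eq_sum (fiberBasis σ b) (fiberBasis σ c) A Z, Complex.re_sum]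
    refine Finset.sum_congr rfl fun i _ => ?_
    rw [Complex.re_sum]
    refine Finset.sum_congr rfl fun j _ => ?_
    rw [Complex.mul_re, Complex.conj_eq_iff_im.mp (hA i j), zero_mul, sub_zero, fiberMap_elemMap]
  rw [key, key]
  simp only [h]

theorem trace_fiberMap_comp_sub [Module.Finite ℤ F] [Module.Free ℤ F]
    (σ : ℤ →+* ℂ) (y : G →ₗ[ℤ] F) (u : F →ₗ[ℤ] G) (T : Fiber σ F →ₗ[ℂ] Fiber σ G) :
    LinearMap.trace ℂ _ (fiberMap σ y ∘ₗ (T - fiberMap σ u)) =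
      LinearMap.trace ℂ _ (fiberMap σ y ∘ₗ T) - σ (LinearMap.trace ℤ F (y ∘ₗ u)) := by
  rw [eq_sub_iff_add_eq, ← trace_fiberMap, fiberMap_comp, ← map_add, ← LinearMap.comp_add]
  exact congrArg (fun S => LinearMap.trace ℂ _ (fiberMap σ y ∘ₗ S))
    (LinearMap.ext fun x => sub_add_cancel (T x) (fiberMap σ u x))

end RealCombination

/-! ### Descent from `𝓞 L` to `ℤ` -/

section Descent

variable {F : Type*} [AddCommGroup F] [Module.Finite ℤ F] [Module.Free ℤ F]
  {G : Type*} [AddCommGroup G] [Module.Finite ℤ G]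

theorem ConjInvariant.conj_trace {T : ∀ σ : ℤ →+* ℂ, Fiber σ F →ₗ[ℂ] Fiber σ F}
    (hT : ConjInvariant T) (σ : ℤ →+* ℂ) :
    conj (LinearMap.trace ℂ _ (T σ)) = LinearMap.trace ℂ _ (T σ) := by
  classical
  let b := Module.Free.chooseBasis ℤ F
  rw [LinearMap.trace_eq_matrix_trace ℂ (fiberBasis σ b), Matrix.trace, map_sum]
  refine Finset.sum_congr rfl fun i _ => ?_
  rw [Matrix.diag_apply, LinearMap.toMatrix_apply]
  exact hT.conj_repr b b σ i i

/-- Each matrix entry of `y` is a trace against an elementary map, hence an integer bounded by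
Cauchy-Schwarz. -/
theorem finite_setOf_hsNormSq_le [Module.Free ℤ G] (hF : HermitianMetric ℤ F)
    (hG : HermitianMetric ℤ G) (σ : ℤ →+* ℂ) (B : ℝ) :
    {y : G →ₗ[ℤ] F | hsNormSq (hG.core σ) (hF.core σ) (fiberMap σ y) ≤ B}.Finite := by
  let b := Module.Free.chooseBasis ℤ F
  let c := Module.Free.chooseBasis ℤ G
  let f : (G →ₗ[ℤ] F) → (_ → _ → ℤ) := fun y i j => b.repr (y (c i)) j
  have hf : Function.Injective f := fun y y' h => c.ext fun i =>
    b.repr.injective (Finsupp.ext fun j => congrFun (congrFun h i) j)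
  let K : _ → _ → ℝ := fun i j =>
    hsNormSq (hF.core σ) (hG.core σ) (fiberMap σ (elemMap b c j i))
  let m : _ → _ → ℤ := fun i j => ⌈B * K i j⌉
  refine Set.Finite.of_finite_image (f := f) ?_ hf.injOn
  refine (Set.finite_Icc (-m) m).subset ?_
  rintro _ ⟨y, hy, rfl⟩
  have key : ∀ i j, |f y i j| ≤ m i j := fun i j => by
    have h1 := norm_trace_comp_sq_le (hF.core σ) (hG.core σ) (fiberMap σ y)
      (fiberMap σ (elemMap b c j i))
    rw [← fiberMap_comp, trace_fiberMap, trace_comp_elemMap, eq_intCast, Complex.norm_intCast] at h1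
    have h2 : ((|f y i j| : ℤ) : ℝ) ≤ ((|f y i j| ^ 2 : ℤ) : ℝ) := by
      exact_mod_cast Int.le_self_sq _
    push_cast at h2
    have h3 : (|f y i j| : ℝ) ≤ B * K i j :=
      h2.trans (h1.trans (mul_le_mul_of_nonneg_right hy (hsNormSq_nonneg _ _ _)))
    have h4 := h3.trans (Int.le_ceil _)
    exact_mod_cast h4
  exact ⟨fun i j => (abs_le.mp (key i j)).1, fun i j => (abs_le.mp (key i j)).2⟩

variable {L : Type*} [Field L] [NumberField L]

/-- The trace pairing of an extension class with an integral map is almost as close to an integer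
as over a number field. -/
theorem exists_int_re_trace_sub_le (hF : HermitianMetric ℤ F) (hG : HermitianMetric ℤ G)
    {T : ∀ σ : ℤ →+* ℂ, Fiber σ F →ₗ[ℂ] Fiber σ G} (hT : ConjInvariant T)
    (u : NumberField.RingOfIntegers L ⊗[ℤ] F →ₗ[NumberField.RingOfIntegers L]
      NumberField.RingOfIntegers L ⊗[ℤ] G) (σ : ℤ →+* ℂ) (y : G →ₗ[ℤ] F) :
    ∃ k : ℤ, ((LinearMap.trace ℂ _ (fiberMap σ y ∘ₗ T σ)).re - k) ^ 2 ≤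
      hsNormSq (hG.core σ) (hF.core σ) (fiberMap σ y) *
      ((1 / (Module.finrank ℤ (NumberField.RingOfIntegers L) : ℝ)) *
      ∑ τ, hsNormSq ((hF.baseChange (NumberField.RingOfIntegers L)).core τ)
        ((hG.baseChange (NumberField.RingOfIntegers L)).core τ)
        (familyBaseChange T τ + fiberMap τ u)) := by
  have hyT : ConjInvariant fun ρ => fiberMap ρ y ∘ₗ T ρ := fun ρ x => by
    simp only [LinearMap.comp_apply, hT ρ x, fiberMap_conj]
  set t := (LinearMap.trace ℂ _ (fiberMap σ y ∘ₗ T σ)).re with ht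
  have ht' : LinearMap.trace ℂ _ (fiberMap σ y ∘ₗ T σ) = (t : ℂ) :=
    (Complex.conj_eq_iff_re.mp (hyT.conj_trace σ)).symm
  set y' := y.baseChange (NumberField.RingOfIntegers L)
  -- The sign is chosen because `y'` pairs with `T + u` at `τ` to `t + τ (tr (y' u))`.
  obtain ⟨k, hk⟩ := exists_int_sq_sub_le t (-LinearMap.trace _ _ (y' ∘ₗ u))
  refine ⟨k, hk.trans ?_⟩
  rw [mul_left_comm]
  have h0 : 0 ≤ 1 / (Module.finrank ℤ (NumberField.RingOfIntegers L) : ℝ) := by positivity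
  refine mul_le_mul_of_nonneg_left ?_ h0
  rw [Finset.mul_sum]
  refine Finset.sum_le_sum fun τ _ => ?_
  have h1 := norm_trace_comp_sq_le ((hF.baseChange (NumberField.RingOfIntegers L)).core τ)
    ((hG.baseChange (NumberField.RingOfIntegers L)).core τ) (fiberMap τ y')
    (familyBaseChange T τ + fiberMap τ u)
  have h2 : hsNormSq ((hG.baseChange (NumberField.RingOfIntegers L)).core τ)
      ((hF.baseChange (NumberField.RingOfIntegers L)).core τ) (fiberMap τ y') =
      hsNormSq (hG.core σ) (hF.core σ) (fiberMap σ y) := by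
    rw [fiberMap_baseChange, hsNormSq_familyBaseChange]
    exact congrArg (fun ρ => hsNormSq (hG.core ρ) (hF.core ρ) (fiberMap ρ y)) (intEmb_eq _ _)
  have h3 : LinearMap.trace ℂ _ (fiberMap τ y' ∘ₗ (familyBaseChange T τ + fiberMap τ u)) =
      (t : ℂ) - τ (-LinearMap.trace _ _ (y' ∘ₗ u)) := by
    rw [LinearMap.comp_add, map_add, ← fiberMap_comp, trace_fiberMap, map_neg, sub_neg_eq_add,
      fiberMap_baseChange, trace_familyBaseChange_comp, ← ht']
    exact congrArg (· + _) (congrArg (fun ρ => LinearMap.trace ℂ _ (fiberMap ρ y ∘ₗ T ρ))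
      (intEmb_eq _ _))
  rwa [h2, h3] at h1

/-- A family over a number field that represents the inverse image of a class over `ℤ` gives rise to a
representative over `ℤ` whose norm is larger by a factor of at most `2 ^ n - 1`. -/
theorem exists_hsNormSq_sub_le [Module.Free ℤ G] (hF : HermitianMetric ℤ F)
    (hG : HermitianMetric ℤ G)
    {T : ∀ σ : ℤ →+* ℂ, Fiber σ F →ₗ[ℂ] Fiber σ G} (hT : ConjInvariant T)
    (u' : NumberField.RingOfIntegers L ⊗[ℤ] F →ₗ[NumberField.RingOfIntegers L]
      NumberField.RingOfIntegers L ⊗[ℤ] G) (σ : ℤ →+* ℂ) :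
    ∃ u : F →ₗ[ℤ] G, hsNormSq (hF.core σ) (hG.core σ) (T σ - fiberMap σ u) ≤
      (2 ^ (Module.finrank ℤ F * Module.finrank ℤ G) - 1) ^ 2 *
      ((1 / (Module.finrank ℤ (NumberField.RingOfIntegers L) : ℝ)) *
      ∑ τ, hsNormSq ((hF.baseChange (NumberField.RingOfIntegers L)).core τ)
        ((hG.baseChange (NumberField.RingOfIntegers L)).core τ)
        (familyBaseChange T τ + fiberMap τ u')) := by
  let b := Module.Free.chooseBasis ℤ F
  let c := Module.Free.chooseBasis ℤ G
  set E := (1 / (Module.finrank ℤ (NumberField.RingOfIntegers L) : ℝ)) *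
      ∑ τ, hsNormSq ((hF.baseChange (NumberField.RingOfIntegers L)).core τ)
        ((hG.baseChange (NumberField.RingOfIntegers L)).core τ)
        (familyBaseChange T τ + fiberMap τ u') with hE
  have hE0 : 0 ≤ E := mul_nonneg (by positivity)
    (Finset.sum_nonneg fun τ _ => hsNormSq_nonneg _ _ _)
  set cF := hF.core σ
  set cG := hG.core σ
  let _ : NormedAddCommGroup (Fiber σ F →ₗ[ℂ] Fiber σ G) := (hsCore cF cG).toNormedAddCommGroup
  let _ : InnerProductSpace ℂ (Fiber σ F →ₗ[ℂ] Fiber σ G) :=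
    InnerProductSpace.ofCore (hsCore cF cG).toCore
  let _ : InnerProductSpace ℝ (Fiber σ F →ₗ[ℂ] Fiber σ G) := InnerProductSpace.complexToReal
  have hn : ∀ S : Fiber σ F →ₗ[ℂ] Fiber σ G, ‖S‖ ^ 2 = hsNormSq cF cG S := fun S =>
    (inner_self_eq_norm_sq (𝕜 := ℂ) S).symm
  -- Taking adjoints preserves the norm and makes the real scalar product with `π y` equal to the
  -- real part of the trace pairing with `y`.
  let π : (G →ₗ[ℤ] F) →+ (Fiber σ F →ₗ[ℂ] Fiber σ G) :=
    AddMonoidHom.mk' (fun y => coreAdjoint cG cF (fiberMap σ y)) fun y z => by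
      rw [fiberMap_add, coreAdjoint_add]
  have hπ : ∀ y, ‖π y‖ ^ 2 = hsNormSq cG cF (fiberMap σ y) := fun y =>
    (hn _).trans (hsNormSq_coreAdjoint cG cF (fiberMap σ y))
  have hinner : ∀ y S, inner ℝ (π y) S = (LinearMap.trace ℂ _ (fiberMap σ y ∘ₗ S)).re :=
    fun y S => by
      change (LinearMap.trace ℂ _ (coreAdjoint cF cG (coreAdjoint cG cF (fiberMap σ y)) ∘ₗ S)).re
        = _
      rw [coreAdjoint_coreAdjoint]
  let t : (G →ₗ[ℤ] F) →+ ℝ :=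
    AddMonoidHom.mk' (fun y => (LinearMap.trace ℂ _ (fiberMap σ y ∘ₗ T σ)).re) fun y z => by
      rw [fiberMap_add, LinearMap.add_comp, map_add, Complex.add_re]
  obtain ⟨φ, r, hr, hrn⟩ := exists_int_functional (Module.finrank ℤ F * Module.finrank ℤ G)
    (by rw [Module.finrank_linearMap, mul_comm]) π
    (fun B => (finite_setOf_hsNormSq_le hF hG σ (B ^ 2)).subset fun y hy => by
      rw [Set.mem_ofPred_eq, ← hπ]
      exact pow_le_pow_left₀ (norm_nonneg _) hy 2)
    t (Real.sqrt_nonneg E) fun y => by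
      obtain ⟨k, hk⟩ := exists_int_re_trace_sub_le hF hG hT u' σ y
      refine ⟨k, abs_le_of_sq_le_sq ?_ (by positivity)⟩
      rw [mul_pow, Real.sq_sqrt hE0, hπ, mul_comm]
      exact hk
  obtain ⟨u, hu⟩ := exists_trace_comp_eq φ.toIntLinearMap
  refine ⟨u, ?_⟩
  set D : ∀ ρ : ℤ →+* ℂ, Fiber ρ F →ₗ[ℂ] Fiber ρ G := fun ρ => T ρ - fiberMap ρ u
  have hD : ConjInvariant D := fun ρ x => by
    simp only [D, LinearMap.sub_apply, hT ρ x, fiberMap_conj, map_sub]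
  -- `r` need not equal `D σ`, but both have the same real pairing with every integral `y`, hence
  -- with the adjoint of `D σ`, a real combination of such maps. So `‖D σ‖ ^ 2 = Re ⟨D σ, r⟩`, and
  -- Cauchy-Schwarz bounds `‖D σ‖` by `‖r‖`.
  have h1 : (LinearMap.trace ℂ _ (coreAdjoint cF cG (D σ) ∘ₗ D σ)).re =
      (LinearMap.trace ℂ _ (coreAdjoint cF cG (D σ) ∘ₗ r)).re := by
    refine re_trace_comp_congr b c σ (fun i j => conj_repr_coreAdjoint cF cG (fiberBasis σ b)
      (fiberBasis σ c) (hF.conj_inner_fiberBasis b σ) (hG.conj_inner_fiberBasis c σ)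
      (hD.conj_repr b c σ) i j) fun y => ?_
    have h2 := hr y
    rw [hinner] at h2
    refine (congrArg Complex.re (trace_fiberMap_comp_sub σ y u (T σ))).trans ?_
    rw [← h2, hu, Complex.sub_re]
    simp [t]
  change hsNormSq cF cG (D σ) ≤ _
  set q := hsNormSq cF cG (D σ) with hq
  have hq0 : 0 ≤ q := hsNormSq_nonneg _ _ _
  have h3 : q ^ 2 ≤ q * ‖r‖ ^ 2 := by
    have h4 := norm_trace_comp_sq_le cF cG (coreAdjoint cF cG (D σ)) r
    rw [hsNormSq_coreAdjoint, ← hn r] at h4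
    refine le_trans ?_ h4
    rw [hq, hsNormSq_eq, h1, ← sq_abs]
    exact pow_le_pow_left₀ (abs_nonneg _) (Complex.abs_re_le_norm _) 2
  have h5 : q ≤ ‖r‖ ^ 2 := by
    rcases hq0.eq_or_lt with h | h
    · rw [← h]; positivity
    · rw [sq q] at h3
      exact le_of_mul_le_mul_left h3 h
  have h6 := pow_le_pow_left₀ (norm_nonneg _) hrn 2
  rw [mul_pow, Real.sq_sqrt hE0] at h6
  exact h5.trans h6

end Descent

/-! ### The constant, the mean norms and the conclusion -/

/-- For `n ≥ 2` already `2 ^ n ≤ n ^ n`. The `- 1` is needed at `n = 1`, where both sides equal `1`;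
at `n = 0` the convention `Real.log 0 = 0` agrees with `s(0) = 0`. -/
theorem two_pow_sub_one_le_exp (n : ℕ) :
    (2 : ℝ) ^ n - 1 ≤ Real.exp (3 / 2 * (n : ℝ) * Real.log (n : ℝ)) := by
  rcases n with _ | _ | n
  · simp
  · norm_num
  · have h2 : Real.log 2 ≤ Real.log ((n + 2 : ℕ) : ℝ) :=
      Real.log_le_log two_pos (by push_cast; linarith [(Nat.cast_nonneg n : (0 : ℝ) ≤ n)])
    have h0 : 0 ≤ Real.log 2 := (Real.log_pos one_lt_two).le
    have h3 : (2 : ℝ) ^ (n + 2) = Real.exp (((n + 2 : ℕ) : ℝ) * Real.log 2) := by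
      rw [Real.exp_nat_mul, Real.exp_log two_pos]
    have h4 : ((n + 2 : ℕ) : ℝ) * Real.log 2 ≤
        3 / 2 * ((n + 2 : ℕ) : ℝ) * Real.log ((n + 2 : ℕ) : ℝ) := by
      refine (mul_le_mul_of_nonneg_left h2 (Nat.cast_nonneg _)).trans ?_
      have := mul_nonneg (Nat.cast_nonneg (α := ℝ) (n + 2)) (h0.trans h2)
      linarith
    have h5 := Real.exp_le_exp.mpr h4
    rw [← h3] at h5
    exact (sub_le_self _ zero_le_one).trans h5

/-- The Hilbert-Schmidt mean entering the size, over `Spec ℤ`. -/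
theorem mean_hsNormSq_int {F G : Type*} [AddCommGroup F] [Module.Finite ℤ F] [AddCommGroup G]
    [Module.Finite ℤ G] (hF : HermitianMetric ℤ F) (hG : HermitianMetric ℤ G)
    (T : ∀ σ : ℤ →+* ℂ, Fiber σ F →ₗ[ℂ] Fiber σ G) (σ : ℤ →+* ℂ) :
    (1 / (Module.finrank ℤ ℤ : ℝ)) * ∑ ρ, hsNormSq (hF.core ρ) (hG.core ρ) (T ρ) =
      hsNormSq (hF.core σ) (hG.core σ) (T σ) := by
  rw [Module.finrank_self, Nat.cast_one, div_one, one_mul]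
  exact Fintype.sum_subsingleton _ σ

theorem mean_hsNormSq_familyBaseChange (L : Type*) [Field L] [NumberField L]
    {F G : Type*} [AddCommGroup F] [Module.Finite ℤ F] [AddCommGroup G]
    [Module.Finite ℤ G] (hF : HermitianMetric ℤ F) (hG : HermitianMetric ℤ G)
    (T : ∀ σ : ℤ →+* ℂ, Fiber σ F →ₗ[ℂ] Fiber σ G) (σ : ℤ →+* ℂ) :
    (1 / (Module.finrank ℤ (NumberField.RingOfIntegers L) : ℝ)) *
      ∑ τ, hsNormSq ((hF.baseChange (NumberField.RingOfIntegers L)).core τ)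
        ((hG.baseChange (NumberField.RingOfIntegers L)).core τ) (familyBaseChange T τ) =
      hsNormSq (hF.core σ) (hG.core σ) (T σ) := by
  have h : ∀ τ : NumberField.RingOfIntegers L →+* ℂ,
      hsNormSq ((hF.baseChange (NumberField.RingOfIntegers L)).core τ)
        ((hG.baseChange (NumberField.RingOfIntegers L)).core τ) (familyBaseChange T τ) =
      hsNormSq (hF.core σ) (hG.core σ) (T σ) := fun τ => by
    rw [hsNormSq_familyBaseChange]
    exact congrArg (fun ρ => hsNormSq (hF.core ρ) (hG.core ρ) (T ρ)) (intEmb_eq _ _)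
  have hd : (Module.finrank ℤ (NumberField.RingOfIntegers L) : ℝ) ≠ 0 :=
    Nat.cast_ne_zero.mpr Module.finrank_pos.ne'
  rw [Finset.sum_congr rfl fun τ _ => h τ, Finset.sum_const, Finset.card_univ, card_emb,
    nsmul_eq_mul, ← mul_assoc, one_div_mul_cancel hd, one_mul]

end Arakelov

theorem mainTheorem11 (L : Type*) [Field L] [NumberField L]
    (F : Type*) [AddCommGroup F] [Module.Finite ℤ F] [Module.Projective ℤ F]
    (G : Type*) [AddCommGroup G] [Module.Finite ℤ G] [Module.Projective ℤ G]
    (hF : Arakelov.HermitianMetric ℤ F) (hG : Arakelov.HermitianMetric ℤ G)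
    (e : Arakelov.ArithExt ℤ F G) (n : ℕ)
    (hn : n = Module.finrank ℤ F * Module.finrank ℤ G) :
    Arakelov.size hF hG e - ((3 / 2 * (n : ℝ) * Real.log (n : ℝ) : ℝ) : EReal) ≤
      Arakelov.size (hF.baseChange (NumberField.RingOfIntegers L))
        (hG.baseChange (NumberField.RingOfIntegers L))
        (e.baseChange (NumberField.RingOfIntegers L)) ∧
    Arakelov.size (hF.baseChange (NumberField.RingOfIntegers L))
        (hG.baseChange (NumberField.RingOfIntegers L))
        (e.baseChange (NumberField.RingOfIntegers L)) ≤
      Arakelov.size hF hG e := by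
  have : Module.Free ℤ F := Module.free_of_finite_type_torsion_free'
  have : Module.Free ℤ G := Module.free_of_finite_type_torsion_free'
  let σ : ℤ →+* ℂ := Int.castRingHom ℂ
  constructor
  · set s : ℝ := 3 / 2 * (n : ℝ) * Real.log (n : ℝ)
    have hs : (s : EReal) = ENNReal.log (ENNReal.ofReal (Real.exp s)) := by
      rw [ENNReal.log_ofReal_of_pos (Real.exp_pos s), Real.log_exp]
    have hs0 : ENNReal.ofReal (Real.exp s) ≠ 0 := (ENNReal.ofReal_pos.mpr (Real.exp_pos s)).ne'
    rw [EReal.sub_le_iff_le_add (.inl (EReal.coe_ne_bot s)) (.inl (EReal.coe_ne_top s)), hs]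
    unfold Arakelov.size
    rw [← ENNReal.log_mul_add]
    refine ENNReal.log_monotone ?_
    -- The factor `exp s`, neither `0` nor `∞`, is moved across so that the infimum over `𝓞 L`
    -- stands alone and can be tested on a single `T'`.
    rw [← ENNReal.div_le_iff_le_mul (.inl hs0) (.inl ENNReal.ofReal_ne_top)]
    refine le_iInf fun T' => le_iInf fun hT' => le_iInf fun he => ?_
    rw [ENNReal.div_le_iff_le_mul (.inl hs0) (.inl ENNReal.ofReal_ne_top)]
    obtain ⟨T, hT, rfl⟩ := Arakelov.exists_classOf_eq e
    -- Any competitor `T'` over `𝓞 L` is the pullback of `T` plus an `𝓞 L`-linear map `u'`.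
    rw [Arakelov.baseChange_classOf, eq_comm, Arakelov.classOf_eq_iff] at he
    obtain ⟨u', hu'⟩ := he
    obtain ⟨u, hu⟩ := Arakelov.exists_hsNormSq_sub_le hF hG hT u' σ
    simp only [← hu'] at hu
    have hD : Arakelov.ConjInvariant fun ρ => T ρ - Arakelov.fiberMap ρ u := fun ρ x => by
      simp only [LinearMap.sub_apply, hT ρ x, Arakelov.fiberMap_conj, map_sub]
    refine iInf_le_of_le (fun ρ => T ρ - Arakelov.fiberMap ρ u)
      (iInf_le_of_le hD (iInf_le_of_le ?_ ?_))
    · rw [Arakelov.classOf_eq_iff]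
      exact ⟨u, fun ρ => LinearMap.ext fun x =>
        (sub_add_cancel (T ρ x) (Arakelov.fiberMap ρ u x)).symm⟩
    · rw [Arakelov.mean_hsNormSq_int hF hG _ σ, mul_comm, ← ENNReal.ofReal_mul (Real.exp_pos s).le]
      refine ENNReal.ofReal_le_ofReal ?_
      have h1 := Real.sqrt_le_sqrt hu
      have h2 : (0 : ℝ) ≤ 2 ^ n - 1 := sub_nonneg.mpr (one_le_pow₀ one_le_two)
      rw [← hn, Real.sqrt_mul (sq_nonneg _), Real.sqrt_sq h2] at h1
      exact h1.trans (mul_le_mul_of_nonneg_right (Arakelov.two_pow_sub_one_le_exp n)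
        (Real.sqrt_nonneg _))
  · refine ENNReal.log_monotone (le_iInf fun T => le_iInf fun hT => le_iInf fun he => ?_)
    -- Each representative of `e` pulls back to a representative of the inverse image with the same
    -- mean norm.
    refine iInf_le_of_le (Arakelov.familyBaseChange T)
      (iInf_le_of_le hT.familyBaseChange (iInf_le_of_le ?_ ?_))
    · rw [← Arakelov.baseChange_classOf hT, he]
    · rw [Arakelov.mean_hsNormSq_familyBaseChange L hF hG T σ,
        Arakelov.mean_hsNormSq_int hF hG T σ]
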